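/- There are absolute constants $C, K > 0$ such that the following holds. Let $2 \le m \le n$, and let $\mathcal A = (A_1,\dots,A_k)$, with $A_i \in \mathbb R^{m\times n}$ not all zero, be an operator of size $s(\mathcal A) = \sum_i \|A_i\|_F^2$. Suppose that $\mathcal A$ is $\varepsilon$-nearly doubly balanced, i.e. $$(1-\varepsilon)\tfrac{s(\mathcal A)}{m} I_m \preceq \sum_i A_iA_i^{*} \preceq (1+\varepsilon)\tfrac{s(\mathcal A)}{m} I_m, \qquad (1-\varepsilon)\tfrac{s(\mathcal A)}{n} I_n \preceq \sum_i A_i^{*}A_i \preceq (1+\varepsilon)\tfrac{s(\mathcal A)}{n} I_n ,$$ and that it has a $\lambda$-spectral gap with $\lambda>0$, i.e. the second largest singular value satisfies $\sigma_2\big(\sum_i A_i\otimes A_i\big) \le (1-\lambda)\, s(\mathcal A)/\sqrt{mn}$, where $\lambda^2 \ge C\varepsilon\log m$. Consider the gradient flow $\mathcal A^{(t)}$, $t \ge 0$, with $\mathcal A^{(0)}=\mathcal A$ and $$\tfrac{d}{dt}A_i = \Big(s(\mathcal A) I_m - m\sum_j A_jA_j^{*}\Big)A_i + A_i\Big(s(\mathcal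 A) I_n - n\sum_j A_j^{*}A_j\Big) \qquad (1\le i\le k).$$ It exists for all $t\ge 0$. Writing $s^{(t)} = s(\mathcal A^{(t)})$ and $\Delta^{(t)} = \Delta(\mathcal A^{(t)})$, where $$\Delta(\mathcal A) = \tfrac1m\Big\|s(\mathcal A) I_m - m\sum_i A_iA_i^{*}\Big\|_F^2 + \tfrac1n\Big\|s(\mathcal A) I_n - n\sum_i A_i^{*}A_i\Big\|_F^2 ,$$ one has $$\Delta^{(t)} \le \Delta^{(0)} e^{-\lambda s^{(0)} t}\qquad\text{for all } t\ge 0 .$$ Moreover, every $\mathcal A^{(t)}$ with $t \ge 0$ is a scaling $(L A_1 R,\dots,L A_k R)$ of $\mathcal A$ with invertible $L \in \mathbb R^{m\times m}$, $R \in \mathbb R^{n\times n}$, and for every $\eta>0$ it is $\eta$-nearly doubly balanced for all $t\ge 0$ with $t \ge \frac{K}{\lambda s^{(0)}}\log\frac m\eta$. Finally, an exact scaling exists: there are invertible $L\in\mathbb R^{m\times m}$ and $R\in\mathbb R^{n\times n}$ with $\sum_i (LA_iR)(LA_iR)^{*} = \frac1m I_m$ and $\sum_i (LA_iR)^{*}(LA_iR)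 = \frac1n I_n$. -/

import Mathlib

namespace OperatorScaling

open scoped Kronecker

variable {m n k : ℕ}

/-- The squared Frobenius norm of a real matrix. -/
def frobSq (B : Matrix (Fin m) (Fin n) ℝ) : ℝ :=
  ∑ a, ∑ b, B a b ^ 2

/-- An operator is a tuple of `k` real `m × n` matrices; its size is `∑ i, ‖A i‖_F ^ 2`. -/
def size (A : Fin k → Matrix (Fin m) (Fin n) ℝ) : ℝ :=
  ∑ i, frobSq (A i)

/-- The `m × m` matrix `∑ i, A i * (A i)ᵀ`. -/
def leftMarginal (A : Fin k → Matrix (Fin m) (Fin n) ℝ) : Matrix (Fin m) (Fin m) ℝ :=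
  ∑ i, A i * (A i).transpose

/-- The `n × n` matrix `∑ i, (A i)ᵀ * A i`. -/
def rightMarginal (A : Fin k → Matrix (Fin m) (Fin n) ℝ) : Matrix (Fin n) (Fin n) ℝ :=
  ∑ i, (A i).transpose * A i

/-- `A` is `ε`-nearly doubly balanced; the four conjuncts are the inequalities in the
positive semidefinite order. -/
def NearlyDoublyBalanced (ε : ℝ) (A : Fin k → Matrix (Fin m) (Fin n) ℝ) : Prop :=
  (leftMarginal A - ((1 - ε) * (size A / m)) • (1 : Matrix (Fin m) (Fin m) ℝ)).PosSemidef ∧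
  (((1 + ε) * (size A / m)) • (1 : Matrix (Fin m) (Fin m) ℝ) - leftMarginal A).PosSemidef ∧
  (rightMarginal A - ((1 - ε) * (size A / n)) • (1 : Matrix (Fin n) (Fin n) ℝ)).PosSemidef ∧
  (((1 + ε) * (size A / n)) • (1 : Matrix (Fin n) (Fin n) ℝ) - rightMarginal A).PosSemidef

/-- The `m² × n²` matrix `∑ i, A i ⊗ A i`. -/
def matrixRep (A : Fin k → Matrix (Fin m) (Fin n) ℝ) :
    Matrix (Fin m × Fin m) (Fin n × Fin n) ℝ :=
  ∑ i, A i ⊗ₖ A i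

/-- The second largest singular value, counted with multiplicity, of `∑ i, A i ⊗ A i`
(the sequence `LinearMap.singularValues` is decreasing and starts at index `0`). -/
noncomputable def sigmaTwo (A : Fin k → Matrix (Fin m) (Fin n) ℝ) : ℝ :=
  (Matrix.toEuclideanLin (matrixRep A)).singularValues 1

/-- `A` has a `lam`-spectral gap. -/
def HasSpectralGap (lam : ℝ) (A : Fin k → Matrix (Fin m) (Fin n) ℝ) : Prop :=
  sigmaTwo A ≤ (1 - lam) * (size A / Real.sqrt ((m : ℝ) * (n : ℝ)))

/-- The left error matrix `s • I - m • ∑ i, A i * (A i)ᵀ`. -/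
def errL (A : Fin k → Matrix (Fin m) (Fin n) ℝ) : Matrix (Fin m) (Fin m) ℝ :=
  size A • (1 : Matrix (Fin m) (Fin m) ℝ) - (m : ℝ) • leftMarginal A

/-- The right error matrix `s • I - n • ∑ i, (A i)ᵀ * A i`. -/
def errR (A : Fin k → Matrix (Fin m) (Fin n) ℝ) : Matrix (Fin n) (Fin n) ℝ :=
  size A • (1 : Matrix (Fin n) (Fin n) ℝ) - (n : ℝ) • rightMarginal A

/-- The `ℓ₂`-error `Δ(A)`. -/
noncomputable def delta (A : Fin k → Matrix (Fin m) (Fin n) ℝ) : ℝ :=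
  1 / (m : ℝ) * frobSq (errL A) + 1 / (n : ℝ) * frobSq (errR A)

/-- `X` solves the gradient flow `dA i / dt = E * A i + A i * F` (entry by entry) for all
times `t ≥ 0`, with initial value `A`; at `t = 0` the derivative is one-sided. -/
def IsGradientFlow (A : Fin k → Matrix (Fin m) (Fin n) ℝ)
    (X : ℝ → Fin k → Matrix (Fin m) (Fin n) ℝ) : Prop :=
  X 0 = A ∧
  ∀ t : ℝ, 0 ≤ t → ∀ (i : Fin k) (a : Fin m) (b : Fin n),
    HasDerivWithinAt (fun τ => X τ i a b)
      ((errL (X t) * X t i + X t i * errR (X t)) a b) (Set.Ici 0) t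

/-- `B` is a scaling of `A`: `B i = L * A i * R` for all `i`, with invertible `L` and `R`. -/
def IsScaling (A B : Fin k → Matrix (Fin m) (Fin n) ℝ) : Prop :=
  ∃ (L : Matrix (Fin m) (Fin m) ℝ) (R : Matrix (Fin n) (Fin n) ℝ),
    IsUnit L ∧ IsUnit R ∧ ∀ i, B i = L * A i * R

end OperatorScaling

/-! Write E = `errL`, F = `errR`, s = `size`, Δ = `delta`, and s₀ for the size at time 0. Along the
flow s' = -2Δ and Δ' = -4 ∑ ‖E A_i + A_i F‖² (`IsFlow.size`, `IsFlow.delta`). Expanding the square,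
the diagonal terms are about sΔ, and the cross term is twice a value of the bilinear form `bil` of ∑
A_i ⊗ A_i. Because tr F = 0, F is orthogonal to the identity, which is almost a top right singular
vector. A spectral gap therefore keeps the cross term a definite fraction below sΔ, and Δ decays
exponentially for as long as the gap lasts (`le_sum_fsq_field`).

That the gap lasts is a bootstrap. Suppose Δ ≤ Δ(0) e^{-λ s₀ t} up to time T. Then little size is
lost, and an eigenvalue barrier argument (`IsFlow.symBound`) shows that E and F stay O(ε s₀) in
spectral norm. The Frobenius norm of E is at most √(mΔ), so E eventually decays exponentially as
well. The same estimate for F would cost √n; instead F is damped at a rate of order s and driven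
only by E and Δ (`IsFlow.symBound_errR`). Both errors lie below one function `errorBound` whose time
integral is O(ε log m / λ), hence at most a small multiple of λ. This integral controls the drift of
`bil` (`IsFlow.abs_bil_sub_le`), so three quarters of the gap survive and Δ in fact decays at twice
the assumed rate. A continuity argument closes the loop (`IsGapped.delta_le`).

The initial bound on `bil` comes from σ₂ by Ky Fan's inequality applied to the identity and a
trace-zero matrix (`bil_sq_le_of_hasSpectralGap`). The flow is L A R with L' = E L and R' = R F. The
same integral confines L and R to a compact set of invertible matrices, so a subsequential limit is
a scaling with Δ = 0; normalising it gives the exact scaling (`IsGapped.exists_scalings`). -/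

namespace OperatorScaling

open Matrix

/-! ### Quadratic-form bounds and Frobenius norms. -/

section Algebra

variable {p q : Type*} [Fintype p] [Fintype q]

/-- The quadratic form of `E` is bounded by `g` in absolute value on the unit sphere. -/
def SymBound (g : ℝ) (E : Matrix p p ℝ) : Prop :=
  ∀ v : p → ℝ, |v ⬝ᵥ E *ᵥ v| ≤ g * (v ⬝ᵥ v)

theorem dotProduct_self_nonneg' (v : p → ℝ) : 0 ≤ v ⬝ᵥ v :=
  Finset.sum_nonneg fun i _ => mul_self_nonneg (v i)

theorem SymBound.mono {g h : ℝ} {E : Matrix p p ℝ} (hE : SymBound g E) (hgh : g ≤ h) :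
    SymBound h E := fun v =>
  (hE v).trans (mul_le_mul_of_nonneg_right hgh (dotProduct_self_nonneg' v))

/-- The squared Frobenius norm over arbitrary finite index types. -/
def fsq (B : Matrix p q ℝ) : ℝ := ∑ a, ∑ b, B a b ^ 2

theorem fsq_nonneg (B : Matrix p q ℝ) : 0 ≤ fsq B :=
  Finset.sum_nonneg fun _ _ => Finset.sum_nonneg fun _ _ => sq_nonneg _

theorem eq_zero_of_fsq_eq_zero {B : Matrix p q ℝ} (h : fsq B = 0) : B = 0 := by
  have h1 := (Finset.sum_eq_zero_iff_of_nonneg (fun a _ =>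
    Finset.sum_nonneg fun b _ => sq_nonneg (B a b))).1 h
  ext a b
  have h3 := (Finset.sum_eq_zero_iff_of_nonneg (fun b _ => sq_nonneg (B a b))).1
    (h1 a (Finset.mem_univ _)) b (Finset.mem_univ _)
  simpa using h3

theorem fsq_transpose (B : Matrix p q ℝ) : fsq Bᵀ = fsq B := by
  simp only [fsq, transpose_apply]; exact Finset.sum_comm

theorem fsq_eq_trace (B : Matrix p q ℝ) : fsq B = trace (B * Bᵀ) := by
  simp [fsq, trace, Matrix.mul_apply, sq]

theorem fsq_eq_trace' (B : Matrix p q ℝ) : fsq B = trace (Bᵀ * B) := by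
  rw [trace_mul_comm, fsq_eq_trace]

theorem fsq_eq_sum_col (B : Matrix p q ℝ) : fsq B = ∑ b, (B.col b) ⬝ᵥ (B.col b) := by
  rw [fsq, Finset.sum_comm]; simp [dotProduct, sq, Matrix.col]

theorem trace_transpose_mul_mul (E : Matrix p p ℝ) (U : Matrix p q ℝ) :
    trace (Uᵀ * E * U) = ∑ b, (U.col b) ⬝ᵥ E *ᵥ (U.col b) := by
  simp only [trace, diag, Matrix.mul_assoc]
  refine Finset.sum_congr rfl fun b _ => ?_
  simp [Matrix.mul_apply, dotProduct, mulVec, Matrix.col]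

theorem SymBound.trace_le {g : ℝ} {E : Matrix p p ℝ} (hE : SymBound g E) (U : Matrix p q ℝ) :
    |trace (Uᵀ * E * U)| ≤ g * fsq U := by
  rw [trace_transpose_mul_mul, fsq_eq_sum_col, Finset.mul_sum]
  exact (Finset.abs_sum_le_sum_abs _ _).trans (Finset.sum_le_sum fun b _ => hE _)

/-- Polarisation: the values of the form at g x + E x and g x - E x differ by 4g‖E x‖², and by the
parallelogram law the two bounds add up to 2g(g²‖x‖² + ‖E x‖²). -/
theorem SymBound.mulVec_sq_le {g : ℝ} {E : Matrix p p ℝ} (hE : SymBound g E) (hs : E.IsSymm)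
    (hg : 0 < g) (x : p → ℝ) : (E *ᵥ x) ⬝ᵥ (E *ᵥ x) ≤ g ^ 2 * (x ⬝ᵥ x) := by
  set y := E *ᵥ x with hy
  have e1 : x ⬝ᵥ E *ᵥ y = y ⬝ᵥ y := by
    rw [dotProduct_mulVec, ← mulVec_transpose, hs.eq]
  have e2 : y ⬝ᵥ E *ᵥ x = y ⬝ᵥ y := by rw [← hy]
  have h1 := (abs_le.1 (hE (g • x + y))).2
  have h2 := (abs_le.1 (hE (g • x - y))).1
  simp only [mulVec_add, mulVec_sub, mulVec_smul, add_dotProduct, sub_dotProduct, dotProduct_add,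
    dotProduct_sub, smul_dotProduct, dotProduct_smul, e1, e2, smul_eq_mul] at h1 h2
  have e3 : x ⬝ᵥ y = y ⬝ᵥ x := dotProduct_comm _ _
  have e4 : x ⬝ᵥ E *ᵥ x = x ⬝ᵥ y := rfl
  rw [e3] at h1 h2
  have h4 : 4 * g * (y ⬝ᵥ y) ≤ 2 * g * (g ^ 2 * (x ⬝ᵥ x) + y ⬝ᵥ y) := by nlinarith
  nlinarith

theorem SymBound.fsq_mul_le {g : ℝ} {E : Matrix p p ℝ} (hE : SymBound g E) (hs : E.IsSymm)
    (hg : 0 < g) (U : Matrix p q ℝ) : fsq (E * U) ≤ g ^ 2 * fsq U := by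
  rw [fsq_eq_sum_col, fsq_eq_sum_col, Finset.mul_sum]
  refine Finset.sum_le_sum fun b _ => ?_
  have : (E * U).col b = E *ᵥ U.col b := by
    ext i; simp [Matrix.mul_apply, mulVec, dotProduct, Matrix.col]
  rw [this]
  exact hE.mulVec_sq_le hs hg _

theorem SymBound.fsq_mul_le' {g : ℝ} {E : Matrix q q ℝ} (hE : SymBound g E) (hs : E.IsSymm)
    (hg : 0 < g) (U : Matrix p q ℝ) : fsq (U * E) ≤ g ^ 2 * fsq U := by
  rw [← fsq_transpose, ← fsq_transpose U, transpose_mul, hs.eq]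
  exact hE.fsq_mul_le hs hg _

/-- The operator norm is at most the Frobenius norm. -/
theorem symBound_of_fsq_le {g : ℝ} (hg : 0 ≤ g) {E : Matrix p p ℝ} (h : fsq E ≤ g ^ 2) :
    SymBound g E := by
  intro v
  have h1 : (v ⬝ᵥ E *ᵥ v) ^ 2 ≤ (v ⬝ᵥ v) * ((E *ᵥ v) ⬝ᵥ (E *ᵥ v)) := by
    have := Finset.sum_mul_sq_le_sq_mul_sq Finset.univ v (E *ᵥ v)
    simpa [dotProduct, sq] using this
  have h2 : (E *ᵥ v) ⬝ᵥ (E *ᵥ v) ≤ fsq E * (v ⬝ᵥ v) := by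
    rw [fsq, Finset.sum_mul, dotProduct]
    refine Finset.sum_le_sum fun a _ => ?_
    have := Finset.sum_mul_sq_le_sq_mul_sq Finset.univ (E a) v
    simpa [mulVec, dotProduct, sq] using this
  have h0 := dotProduct_self_nonneg' v
  refine abs_le_of_sq_le_sq ?_ (mul_nonneg hg h0)
  calc _ ≤ _ := h1
    _ ≤ (v ⬝ᵥ v) * (g ^ 2 * (v ⬝ᵥ v)) :=
        mul_le_mul_of_nonneg_left (h2.trans (mul_le_mul_of_nonneg_right h h0)) h0
    _ = _ := by ring

/-- Cauchy-Schwarz for families of matrices with the Frobenius inner product. -/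
theorem sum_trace_mul_sq_le {ι : Type*} [Fintype ι] (X : ι → Matrix p q ℝ)
    (Y : ι → Matrix q p ℝ) :
    (∑ i, trace (X i * Y i)) ^ 2 ≤ (∑ i, fsq (X i)) * ∑ i, fsq (Y i) := by
  have h := Finset.sum_mul_sq_le_sq_mul_sq (Finset.univ : Finset (ι × p × q))
    (fun z => X z.1 z.2.1 z.2.2) (fun z => Y z.1 z.2.2 z.2.1)
  simp only [Fintype.sum_prod_type] at h
  refine le_trans (le_of_eq ?_) (h.trans (le_of_eq ?_))
  · simp [trace, Matrix.mul_apply]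
  · congr 1
    simp only [fsq]
    exact Finset.sum_congr rfl fun i _ => Finset.sum_comm

end Algebra

/-! ### Marginals, error matrices and trace identities along the flow field. -/

section Operator

variable {m n k : ℕ}

theorem frobSq_eq_fsq (B : Matrix (Fin m) (Fin n) ℝ) : frobSq B = fsq B := rfl

/-- The operator formed by the transposed matrices. -/
def transposeOp (A : Fin k → Matrix (Fin m) (Fin n) ℝ) : Fin k → Matrix (Fin n) (Fin m) ℝ :=
  fun i => (A i)ᵀ

variable (A : Fin k → Matrix (Fin m) (Fin n) ℝ)

theorem size_transposeOp : size (transposeOp A) = size A := by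
  simp only [size, transposeOp, frobSq_eq_fsq, fsq_transpose]

theorem leftMarginal_transposeOp : leftMarginal (transposeOp A) = rightMarginal A := by
  simp [leftMarginal, rightMarginal, transposeOp]

theorem rightMarginal_transposeOp : rightMarginal (transposeOp A) = leftMarginal A := by
  simp [leftMarginal, rightMarginal, transposeOp]

theorem errL_transposeOp : errL (transposeOp A) = errR A := by
  simp [errL, errR, leftMarginal_transposeOp, size_transposeOp]

theorem errR_transposeOp : errR (transposeOp A) = errL A := by
  simp [errL, errR, rightMarginal_transposeOp, size_transposeOp]

theorem delta_transposeOp : delta (transposeOp A) = delta A := by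
  rw [delta, delta, errR_transposeOp, errL_transposeOp, add_comm]

theorem size_nonneg : 0 ≤ size A := Finset.sum_nonneg fun _ _ => fsq_nonneg _

theorem delta_nonneg : 0 ≤ delta A := by
  have h1 := fsq_nonneg (errL A)
  have h2 := fsq_nonneg (errR A)
  rw [delta, frobSq_eq_fsq, frobSq_eq_fsq]
  positivity

theorem size_pos (hA : A ≠ 0) : 0 < size A := by
  rcases (size_nonneg A).lt_or_eq with h | h
  · exact h
  · exfalso
    apply hA
    have h1 := (Finset.sum_eq_zero_iff_of_nonneg (fun i _ => fsq_nonneg (A i))).1 h.symm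
    exact funext fun i => eq_zero_of_fsq_eq_zero (h1 i (Finset.mem_univ _))

theorem isSymm_leftMarginal : (leftMarginal A).IsSymm := by
  simp [Matrix.IsSymm, leftMarginal, transpose_sum]

theorem isSymm_errL : (errL A).IsSymm := by
  simp [Matrix.IsSymm, errL, (isSymm_leftMarginal A).eq]

theorem isSymm_errR : (errR A).IsSymm := by
  rw [← errL_transposeOp]; exact isSymm_errL _

theorem trace_leftMarginal : trace (leftMarginal A) = size A := by
  simp [leftMarginal, trace_sum, size, frobSq_eq_fsq, fsq_eq_trace]

theorem trace_errL : trace (errL A) = 0 := by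
  simp [errL, trace_leftMarginal]; ring

theorem trace_errR : trace (errR A) = 0 := by
  rw [← errL_transposeOp, trace_errL]

theorem smul_leftMarginal :
    (m : ℝ) • leftMarginal A = size A • (1 : Matrix (Fin m) (Fin m) ℝ) - errL A := by
  simp [errL]

/-- The vector field of the gradient flow. -/
def field (i : Fin k) : Matrix (Fin m) (Fin n) ℝ := errL A * A i + A i * errR A

theorem field_transposeOp (i : Fin k) : field (transposeOp A) i = (field A i)ᵀ := by
  simp only [field, errL_transposeOp, errR_transposeOp, transposeOp, transpose_add, transpose_mul,
    (isSymm_errL A).eq, (isSymm_errR A).eq, add_comm]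

/-- The derivative of the left marginal along the gradient flow. -/
def leftMarginalDeriv : Matrix (Fin m) (Fin m) ℝ :=
  ∑ i, (field A i * (A i)ᵀ + A i * (field A i)ᵀ)

theorem trace_mul_leftMarginalDeriv (W : Matrix (Fin m) (Fin m) ℝ) (hW : W.IsSymm) :
    trace (W * leftMarginalDeriv A) = 2 * ∑ i, trace (W * field A i * (A i)ᵀ) := by
  simp only [leftMarginalDeriv, trace_sum, Finset.mul_sum, Matrix.mul_add,
    trace_add]
  refine Finset.sum_congr rfl fun i _ => ?_
  have : trace (W * (A i * (field A i)ᵀ)) = trace (W * field A i * (A i)ᵀ) := by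
    rw [← trace_transpose, transpose_mul, transpose_mul, transpose_transpose, hW.eq,
      trace_mul_comm, Matrix.mul_assoc]
  rw [this, Matrix.mul_assoc]; ring

theorem sum_trace_mul_left (W : Matrix (Fin m) (Fin m) ℝ) :
    ∑ i, trace (W * A i * (A i)ᵀ) = trace (W * leftMarginal A) := by
  simp [leftMarginal, Matrix.mul_sum, trace_sum, Matrix.mul_assoc]

theorem sum_trace_mul_right (W : Matrix (Fin n) (Fin n) ℝ) :
    ∑ i, trace (A i * W * (A i)ᵀ) = trace (W * rightMarginal A) := by
  simp only [rightMarginal, Matrix.mul_sum, trace_sum]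
  refine Finset.sum_congr rfl fun i _ => ?_
  rw [trace_mul_comm, ← Matrix.mul_assoc, trace_mul_comm]

/-- The scaled marginal is s I - E, and E is trace-free, so only -‖E‖² survives. -/
theorem trace_errL_mul_leftMarginal (hm : m ≠ 0) :
    trace (errL A * leftMarginal A) = -(1 / (m : ℝ) * fsq (errL A)) := by
  have hm' : (m : ℝ) ≠ 0 := by exact_mod_cast hm
  have h : (m : ℝ) * trace (errL A * leftMarginal A) = -fsq (errL A) := by
    rw [← smul_eq_mul, ← trace_smul, ← mul_smul_comm, smul_leftMarginal, Matrix.mul_sub,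
      trace_sub, mul_smul_comm, Matrix.mul_one, trace_smul, trace_errL, fsq_eq_trace,
      (isSymm_errL A).eq]
    simp
  field_simp
  linarith

theorem trace_errR_mul_rightMarginal (hn : n ≠ 0) :
    trace (errR A * rightMarginal A) = -(1 / (n : ℝ) * fsq (errR A)) := by
  rw [← errL_transposeOp, ← leftMarginal_transposeOp]
  exact trace_errL_mul_leftMarginal _ hn

theorem trace_leftMarginalDeriv (hm : m ≠ 0) (hn : n ≠ 0) :
    trace (leftMarginalDeriv A) = -2 * delta A := by
  have h := trace_mul_leftMarginalDeriv A 1 Matrix.isSymm_one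
  simp only [Matrix.one_mul] at h
  rw [h]
  simp only [field, Matrix.add_mul, trace_add, Finset.sum_add_distrib]
  rw [sum_trace_mul_left, sum_trace_mul_right, trace_errL_mul_leftMarginal A hm,
    trace_errR_mul_rightMarginal A hn, delta, frobSq_eq_fsq, frobSq_eq_fsq]
  ring

/-- By cyclicity both traces become inner products of the field with one of its two summands E A_i
and A_i F; together they pair the field with itself. This is what makes Δ decrease. -/
theorem trace_mul_derivs :
    trace (errL A * leftMarginalDeriv A) +
      trace (errR A * leftMarginalDeriv (transposeOp A)) = 2 * ∑ i, fsq (field A i) := by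
  rw [trace_mul_leftMarginalDeriv _ _ (isSymm_errL A),
    trace_mul_leftMarginalDeriv _ _ (isSymm_errR A), ← mul_add, ← Finset.sum_add_distrib]
  congr 1
  refine Finset.sum_congr rfl fun i _ => ?_
  have h1 : trace (errR A * field (transposeOp A) i * (transposeOp A i)ᵀ) =
      trace (field A i * (A i * errR A)ᵀ) := by
    rw [field_transposeOp, transpose_mul, (isSymm_errR A).eq]
    simp only [transposeOp, transpose_transpose]
    rw [← trace_transpose]
    simp only [transpose_mul, transpose_transpose, (isSymm_errR A).eq]
    rw [← Matrix.mul_assoc, trace_mul_comm, ← Matrix.mul_assoc]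
    exact trace_mul_comm _ _
  have h2 : trace (errL A * field A i * (A i)ᵀ) = trace (field A i * (errL A * A i)ᵀ) := by
    rw [transpose_mul, (isSymm_errL A).eq, Matrix.mul_assoc, trace_mul_comm, Matrix.mul_assoc]
  rw [h1, h2, fsq_eq_trace, ← trace_add, ← Matrix.mul_add, ← transpose_add]
  rfl

end Operator

end OperatorScaling

namespace OperatorScaling

open Matrix

/-! ### Eigenvalue derivatives, and the bilinear form in the cross term. -/

section Operator

variable {m n k : ℕ} (A : Fin k → Matrix (Fin m) (Fin n) ℝ)

theorem dotProduct_leftMarginal (v : Fin m → ℝ) :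
    v ⬝ᵥ leftMarginal A *ᵥ v = ∑ i, ((A i)ᵀ *ᵥ v) ⬝ᵥ ((A i)ᵀ *ᵥ v) := by
  rw [leftMarginal, sum_mulVec, dotProduct_sum]
  refine Finset.sum_congr rfl fun i _ => ?_
  rw [← mulVec_mulVec, dotProduct_mulVec, ← mulVec_transpose]

theorem dotProduct_errL (v : Fin m → ℝ) :
    v ⬝ᵥ errL A *ᵥ v = size A * (v ⬝ᵥ v) - m * (v ⬝ᵥ leftMarginal A *ᵥ v) := by
  simp [errL, sub_mulVec, smul_mulVec]

theorem dotProduct_leftMarginalDeriv (v : Fin m → ℝ) {c : ℝ} (hv : errL A *ᵥ v = c • v) :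
    v ⬝ᵥ leftMarginalDeriv A *ᵥ v = 2 * c * (v ⬝ᵥ leftMarginal A *ᵥ v) +
      2 * ∑ i, ((A i)ᵀ *ᵥ v) ⬝ᵥ errR A *ᵥ ((A i)ᵀ *ᵥ v) := by
  rw [leftMarginalDeriv, sum_mulVec, dotProduct_sum, dotProduct_leftMarginal, Finset.mul_sum,
    Finset.mul_sum, ← Finset.sum_add_distrib]
  refine Finset.sum_congr rfl fun i _ => ?_
  have h1 : v ⬝ᵥ (A i * (field A i)ᵀ) *ᵥ v = v ⬝ᵥ (field A i * (A i)ᵀ) *ᵥ v := by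
    rw [← mulVec_mulVec, ← mulVec_mulVec, dotProduct_mulVec, dotProduct_mulVec,
      ← mulVec_transpose, ← mulVec_transpose, dotProduct_comm, transpose_transpose]
  have h2 : v ⬝ᵥ (errL A * A i * (A i)ᵀ) *ᵥ v =
      c * (((A i)ᵀ *ᵥ v) ⬝ᵥ ((A i)ᵀ *ᵥ v)) := by
    rw [Matrix.mul_assoc, ← mulVec_mulVec, dotProduct_mulVec, ← mulVec_transpose,
      (isSymm_errL A).eq, hv, smul_dotProduct, ← mulVec_mulVec, dotProduct_mulVec,
      ← mulVec_transpose, smul_eq_mul]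
  have h3 : v ⬝ᵥ (A i * errR A * (A i)ᵀ) *ᵥ v =
      ((A i)ᵀ *ᵥ v) ⬝ᵥ errR A *ᵥ ((A i)ᵀ *ᵥ v) := by
    rw [Matrix.mul_assoc, ← mulVec_mulVec, dotProduct_mulVec, ← mulVec_transpose, mulVec_mulVec]
  rw [add_mulVec, dotProduct_add, h1, field, Matrix.add_mul, add_mulVec, dotProduct_add, h2, h3]
  ring

/-- The derivative of the left error matrix along the gradient flow. -/
noncomputable def errLDeriv : Matrix (Fin m) (Fin m) ℝ :=
  (-2 * delta A) • (1 : Matrix (Fin m) (Fin m) ℝ) - (m : ℝ) • leftMarginalDeriv A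

/-- On an eigenvector with eigenvalue c, m times the form of the left marginal is (s - c)‖v‖². So
the eigenvalue moves by -2Δ - 2c(s - c), up to a forcing term from the opposite error, which has
size at most 2f(s - c). -/
theorem abs_dotProduct_errLDeriv_le {f c : ℝ} (hf : SymBound f (errR A)) (v : Fin m → ℝ)
    (hv : errL A *ᵥ v = c • v) :
    |v ⬝ᵥ errLDeriv A *ᵥ v + 2 * delta A * (v ⬝ᵥ v) + 2 * c * (size A - c) * (v ⬝ᵥ v)| ≤
      2 * f * (size A - c) * (v ⬝ᵥ v) := by
  have h1 := dotProduct_errL A v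
  rw [hv, dotProduct_smul, smul_eq_mul] at h1
  have h2 : v ⬝ᵥ errLDeriv A *ᵥ v =
      -2 * delta A * (v ⬝ᵥ v) - m * (v ⬝ᵥ leftMarginalDeriv A *ᵥ v) := by
    rw [errLDeriv, sub_mulVec, smul_mulVec, smul_mulVec, one_mulVec]
    simp
  rw [dotProduct_leftMarginalDeriv A v hv] at h2
  set S := ∑ i, ((A i)ᵀ *ᵥ v) ⬝ᵥ errR A *ᵥ ((A i)ᵀ *ᵥ v) with hS
  have h3 : |S| ≤ f * (v ⬝ᵥ leftMarginal A *ᵥ v) := by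
    rw [dotProduct_leftMarginal, Finset.mul_sum]
    exact (Finset.abs_sum_le_sum_abs _ _).trans (Finset.sum_le_sum fun i _ => hf _)
  have h4 : v ⬝ᵥ errLDeriv A *ᵥ v + 2 * delta A * (v ⬝ᵥ v) + 2 * c * (size A - c) * (v ⬝ᵥ v) =
      -(2 * m * S) := by
    rw [h2]
    linear_combination (-2 * c) * h1
  rw [h4, abs_neg, abs_mul, abs_of_nonneg (by positivity : (0 : ℝ) ≤ 2 * m)]
  calc 2 * m * |S| ≤ 2 * m * (f * (v ⬝ᵥ leftMarginal A *ᵥ v)) := by gcongr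
    _ = _ := by linear_combination (2 * f) * h1

theorem sum_fsq_mul {q : Type*} [Fintype q] (U : Matrix (Fin m) q ℝ) :
    m * ∑ i, fsq (Uᵀ * A i) = size A * fsq U - trace (Uᵀ * errL A * U) := by
  have h : ∑ i, fsq (Uᵀ * A i) = trace (Uᵀ * leftMarginal A * U) := by
    simp only [leftMarginal, Matrix.mul_sum, Matrix.sum_mul, trace_sum]
    refine Finset.sum_congr rfl fun i _ => ?_
    rw [fsq_eq_trace, transpose_mul, transpose_transpose]
    simp only [Matrix.mul_assoc]
  rw [h, errL]
  simp [Matrix.mul_sub, Matrix.sub_mul, fsq_eq_trace']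

theorem sum_fsq_mul' {q : Type*} [Fintype q] (V : Matrix (Fin n) q ℝ) :
    n * ∑ i, fsq (A i * V) = size A * fsq V - trace (Vᵀ * errR A * V) := by
  have h := sum_fsq_mul (transposeOp A) V
  rw [errL_transposeOp, size_transposeOp] at h
  rw [← h]
  congr 1
  refine Finset.sum_congr rfl fun i _ => ?_
  rw [← fsq_transpose, transpose_mul]
  rfl

/-- The bilinear form of the matrix `∑ i, A i ⊗ A i`. -/
def bil (U : Matrix (Fin m) (Fin m) ℝ) (V : Matrix (Fin n) (Fin n) ℝ) : ℝ :=
  ∑ i, trace (Uᵀ * A i * V * (A i)ᵀ)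

/-- Cauchy-Schwarz between UᵀA_i and V A_iᵀ, whose total squared norms are governed by the
marginals: near balance alone bounds the spectral norm of ∑ A_i ⊗ A_i by (s + g)/√(mn). -/
theorem mul_bil_sq_le {g : ℝ} (hL : SymBound g (errL A)) (hR : SymBound g (errR A))
    (U : Matrix (Fin m) (Fin m) ℝ) (V : Matrix (Fin n) (Fin n) ℝ) :
    (m * n : ℝ) * bil A U V ^ 2 ≤ (size A + g) ^ 2 * (fsq U * fsq V) := by
  have h1 := sum_fsq_mul A U
  have h2 := sum_fsq_mul' A Vᵀ
  have h3 := (abs_le.1 (hL.trace_le U)).1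
  have h4 := (abs_le.1 (hR.trace_le Vᵀ)).1
  rw [fsq_transpose] at h2 h4
  have h5 := sum_trace_mul_sq_le (fun i => Uᵀ * A i) (fun i => V * (A i)ᵀ)
  have h6 : ∀ i, fsq (V * (A i)ᵀ) = fsq (A i * Vᵀ) := fun i => by
    rw [← fsq_transpose, transpose_mul, transpose_transpose]
  simp only [h6, ← Matrix.mul_assoc] at h5
  change bil A U V ^ 2 ≤ _ at h5
  have p1 : 0 ≤ ∑ i, fsq (Uᵀ * A i) := Finset.sum_nonneg fun i _ => fsq_nonneg _
  have p2 : 0 ≤ ∑ i, fsq (A i * Vᵀ) := Finset.sum_nonneg fun i _ => fsq_nonneg _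
  calc (m * n : ℝ) * bil A U V ^ 2
      ≤ (m * n : ℝ) * ((∑ i, fsq (Uᵀ * A i)) * ∑ i, fsq (A i * Vᵀ)) := by gcongr
    _ = (m * ∑ i, fsq (Uᵀ * A i)) * (n * ∑ i, fsq (A i * Vᵀ)) := by ring
    _ ≤ ((size A + g) * fsq U) * ((size A + g) * fsq V) := by
        apply mul_le_mul
        · rw [h1]; linarith
        · rw [h2]; linarith
        · positivity
        · have : 0 ≤ m * ∑ i, fsq (Uᵀ * A i) := by positivity
          linarith
    _ = _ := by ring

theorem sum_fsq_field :
    ∑ i, fsq (field A i) = ∑ i, fsq (errL A * A i) + ∑ i, fsq (A i * errR A) +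
      2 * bil A (errL A) (errR A) := by
  rw [bil, Finset.mul_sum, ← Finset.sum_add_distrib, ← Finset.sum_add_distrib]
  refine Finset.sum_congr rfl fun i _ => ?_
  have h : trace (errL A * A i * (A i * errR A)ᵀ) = trace (A i * errR A * (errL A * A i)ᵀ) := by
    rw [← trace_transpose, transpose_mul, transpose_transpose]
  rw [field, fsq_eq_trace, transpose_add, Matrix.add_mul, Matrix.mul_add, Matrix.mul_add,
    trace_add, trace_add, trace_add, ← fsq_eq_trace, ← fsq_eq_trace, ← h, transpose_mul,
    (isSymm_errR A).eq, (isSymm_errL A).eq]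
  simp only [Matrix.mul_assoc]
  ring

/-- The squares contribute at least (s - g)Δ. For the cross term, the hypothesis on `bil` and AM-GM
between ‖E‖²/m and ‖F‖²/n give a loss of at most rΔ. -/
theorem le_sum_fsq_field (hm : 0 < m) (hn : 0 < n) {g r : ℝ}
    (hL : SymBound g (errL A)) (hR : SymBound g (errR A)) (hr : 0 ≤ r)
    (hb : (m * n : ℝ) * bil A (errL A) (errR A) ^ 2 ≤ r ^ 2 * (fsq (errL A) * fsq (errR A))) :
    (size A - g - r) * delta A ≤ ∑ i, fsq (field A i) := by
  have hm' : (0 : ℝ) < m := by exact_mod_cast hm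
  have hn' : (0 : ℝ) < n := by exact_mod_cast hn
  have h1 := sum_fsq_mul A (errL A)
  have h2 := sum_fsq_mul' A (errR A)
  have h3 := (abs_le.1 (hL.trace_le (errL A))).2
  have h4 := (abs_le.1 (hR.trace_le (errR A))).2
  rw [(isSymm_errL A).eq] at h1 h3
  rw [(isSymm_errR A).eq] at h2 h4
  rw [sum_fsq_field, delta, frobSq_eq_fsq, frobSq_eq_fsq]
  set x := fsq (errL A)
  set y := fsq (errR A)
  have hx : 0 ≤ x := fsq_nonneg _
  have hy : 0 ≤ y := fsq_nonneg _
  set b := bil A (errL A) (errR A)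
  have h5 : (size A - g) * (1 / m * x) ≤ ∑ i, fsq (errL A * A i) := by
    rw [← mul_le_mul_iff_right₀ hm', h1]
    field_simp
    linarith
  have h6 : (size A - g) * (1 / n * y) ≤ ∑ i, fsq (A i * errR A) := by
    rw [← mul_le_mul_iff_right₀ hn', h2]
    field_simp
    linarith
  have h7 : |2 * b| ≤ r * (1 / m * x + 1 / n * y) := by
    apply abs_le_of_sq_le_sq _ (by positivity)
    have : (2 * b) ^ 2 ≤ 4 * r ^ 2 * ((1 / m * x) * (1 / n * y)) := by
      rw [← mul_le_mul_iff_right₀ (mul_pos hm' hn')]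
      field_simp
      linarith
    nlinarith [mul_nonneg (sq_nonneg r) (sq_nonneg (1 / m * x - 1 / n * y))]
  have := (abs_le.1 h7).1
  linarith

end Operator

end OperatorScaling

namespace OperatorScaling

open Matrix Set

/-! ### Entrywise calculus for matrix-valued curves. -/

section EntryDeriv

variable {p q r : Type*}

/-- Entrywise derivative of a matrix-valued curve within a set. -/
def HasEntryDeriv (X : ℝ → Matrix p q ℝ) (X' : Matrix p q ℝ) (s : Set ℝ) (t : ℝ) : Prop :=
  ∀ a b, HasDerivWithinAt (fun τ => X τ a b) (X' a b) s t

variable {X Y : ℝ → Matrix p q ℝ} {X' Y' : Matrix p q ℝ} {s : Set ℝ} {t : ℝ}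

theorem HasEntryDeriv.congr_deriv (h : HasEntryDeriv X X' s t) (e : X' = Y') :
    HasEntryDeriv X Y' s t := e ▸ h

theorem hasEntryDeriv_const (C : Matrix p q ℝ) : HasEntryDeriv (fun _ => C) 0 s t :=
  fun _ _ => hasDerivWithinAt_const _ _ _

theorem HasEntryDeriv.add (hX : HasEntryDeriv X X' s t) (hY : HasEntryDeriv Y Y' s t) :
    HasEntryDeriv (fun τ => X τ + Y τ) (X' + Y') s t :=
  fun a b => (hX a b).add (hY a b)

theorem HasEntryDeriv.sub (hX : HasEntryDeriv X X' s t) (hY : HasEntryDeriv Y Y' s t) :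
    HasEntryDeriv (fun τ => X τ - Y τ) (X' - Y') s t :=
  fun a b => (hX a b).sub (hY a b)

theorem HasEntryDeriv.const_smul (c : ℝ) (hX : HasEntryDeriv X X' s t) :
    HasEntryDeriv (fun τ => c • X τ) (c • X') s t :=
  fun a b => (hX a b).const_mul c

theorem HasEntryDeriv.smul_const {f : ℝ → ℝ} {f' : ℝ} (hf : HasDerivWithinAt f f' s t)
    (C : Matrix p q ℝ) : HasEntryDeriv (fun τ => f τ • C) (f' • C) s t :=
  fun a b => hf.mul_const (C a b)

theorem HasEntryDeriv.transpose (hX : HasEntryDeriv X X' s t) :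
    HasEntryDeriv (fun τ => (X τ)ᵀ) X'ᵀ s t :=
  fun a b => hX b a

theorem HasEntryDeriv.sum {ι : Type*} [Fintype ι] {Z : ι → ℝ → Matrix p q ℝ}
    {Z' : ι → Matrix p q ℝ} (h : ∀ i, HasEntryDeriv (Z i) (Z' i) s t) :
    HasEntryDeriv (fun τ => ∑ i, Z i τ) (∑ i, Z' i) s t := by
  intro a b
  simp only [Matrix.sum_apply]
  exact HasDerivWithinAt.fun_sum fun i _ => h i a b

theorem HasEntryDeriv.mul [Fintype q] {W : ℝ → Matrix q r ℝ} {W' : Matrix q r ℝ}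
    (hX : HasEntryDeriv X X' s t) (hW : HasEntryDeriv W W' s t) :
    HasEntryDeriv (fun τ => X τ * W τ) (X' * W t + X t * W') s t := by
  intro a b
  simp only [Matrix.add_apply, Matrix.mul_apply, ← Finset.sum_add_distrib]
  exact HasDerivWithinAt.fun_sum fun j _ => (hX a j).mul (hW j b)

theorem HasEntryDeriv.trace [Fintype p] {W : ℝ → Matrix p p ℝ} {W' : Matrix p p ℝ}
    (hW : HasEntryDeriv W W' s t) :
    HasDerivWithinAt (fun τ => (W τ).trace) W'.trace s t :=
  HasDerivWithinAt.fun_sum fun j _ => hW j j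

theorem HasEntryDeriv.fsq [Fintype p] [Fintype q] (hX : HasEntryDeriv X X' s t) :
    HasDerivWithinAt (fun τ => fsq (X τ)) (2 * Matrix.trace ((X t)ᵀ * X')) s t := by
  have h := (hX.transpose.mul hX).trace
  simp only [← fsq_eq_trace'] at h
  convert h using 1
  rw [trace_add, ← trace_transpose (X'ᵀ * X t), transpose_mul, transpose_transpose]
  ring

theorem HasEntryDeriv.dotProduct [Fintype p] {W : ℝ → Matrix p p ℝ} {W' : Matrix p p ℝ}
    (hW : HasEntryDeriv W W' s t) (u v : p → ℝ) :
    HasDerivWithinAt (fun τ => u ⬝ᵥ W τ *ᵥ v) (u ⬝ᵥ W' *ᵥ v) s t := by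
  simp only [_root_.dotProduct, mulVec]
  exact HasDerivWithinAt.fun_sum fun a _ =>
    (HasDerivWithinAt.fun_sum fun b _ => (hW a b).mul_const (v b)).const_mul (u a)

end EntryDeriv

/-! ### First-touching-time arguments for extreme eigenvalues. -/

section Barrier

/-- A compact family of functions stays below a barrier if no member can cross it at a time when
the whole family still is below the barrier. -/
theorem le_of_barrier {V : Type*} [TopologicalSpace V] [T2Space V] {K : Set V} (hK : IsCompact K)
    {φ φ' : V → ℝ → ℝ} {h h' : ℝ → ℝ} {T : ℝ}
    (hc : ContinuousOn (fun z : V × ℝ => φ z.1 z.2) (K ×ˢ Icc 0 T))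
    (hφ : ∀ v ∈ K, ∀ t ∈ Icc 0 T, HasDerivWithinAt (φ v) (φ' v t) (Ici 0) t)
    (hh : ∀ t ∈ Icc 0 T, HasDerivWithinAt h (h' t) (Ici 0) t)
    (h0 : ∀ v ∈ K, φ v 0 < h 0)
    (htouch : ∀ t ∈ Icc 0 T, (∀ w ∈ K, φ w t ≤ h t) → ∀ v ∈ K, φ v t = h t → φ' v t < h' t) :
    ∀ t ∈ Icc 0 T, ∀ v ∈ K, φ v t ≤ h t := by
  by_contra! hcon
  obtain ⟨t₀, ht₀, v₀, hv₀, hlt₀⟩ := hcon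
  have hhc : ContinuousOn h (Icc 0 T) := fun t ht =>
    (hh t ht).continuousWithinAt.mono Icc_subset_Ici_self
  -- The pairs at or above the barrier form a compact set, so there is an earliest such time T₂.
  have hZc : IsCompact ((K ×ˢ Icc 0 T) ∩ {z : V × ℝ | h z.2 ≤ φ z.1 z.2}) := by
    have hKc : IsCompact (K ×ˢ Icc (0 : ℝ) T) := hK.prod isCompact_Icc
    exact hKc.of_isClosed_subset (hKc.isClosed.isClosed_le
      (hhc.comp continuousOn_snd fun z hz => hz.2) hc) fun z hz => hz.1
  obtain ⟨T₁, hT₁⟩ := 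
    (hZc.image continuous_snd).exists_isLeast ⟨t₀, ⟨(v₀, t₀), ⟨⟨hv₀, ht₀⟩, hlt₀.le⟩, rfl⟩⟩
  obtain ⟨⟨⟨v, T₂⟩, ⟨⟨hv, hT⟩, hle⟩, rfl⟩, hmin⟩ := hT₁
  simp only at hv hT hle hmin
  have hbelow : ∀ t ∈ Ico 0 T₂, ∀ w ∈ K, φ w t < h t := by
    intro t ht w hw
    by_contra! hge
    exact absurd (hmin ⟨(w, t), ⟨⟨hw, ht.1, ht.2.le.trans hT.2⟩, hge⟩, rfl⟩) (not_le.2 ht.2)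
  have hpos : 0 < T₂ := by
    rcases hT.1.lt_or_eq with h1 | h1
    · exact h1
    · exact absurd (h0 v hv) (not_lt.2 (h1 ▸ hle))
  have hsub : Ico 0 T₂ ⊆ Ici (0 : ℝ) := fun t ht => ht.1
  have hne : (nhdsWithin T₂ (Ico 0 T₂)).NeBot := by
    rw [← mem_closure_iff_nhdsWithin_neBot, closure_Ico hpos.ne]
    exact ⟨hpos.le, le_rfl⟩
  have hat : ∀ w ∈ K, φ w T₂ ≤ h T₂ := by
    intro w hw
    have c1 := ((hφ w hw T₂ hT).continuousWithinAt.mono hsub)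
    have c2 := ((hh T₂ hT).continuousWithinAt.mono hsub)
    refine le_of_tendsto_of_tendsto c1 c2 ?_
    filter_upwards [self_mem_nhdsWithin] with t ht using (hbelow t ht w hw).le
  have heq := le_antisymm (hat v hv) hle
  have hlt := htouch T₂ hT hat v hv heq
  have hd := ((hφ v hv T₂ hT).sub (hh T₂ hT)).mono hsub
  rw [hasDerivWithinAt_iff_tendsto_slope] at hd
  have hdiff : Ico 0 T₂ \ {T₂} = Ico 0 T₂ := by
    ext x; simp only [mem_sdiff, mem_singleton_iff, and_iff_left_iff_imp]; exact fun hx => hx.2.ne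
  rw [hdiff] at hd
  -- The difference of φ and the barrier is negative before T₂ and zero at T₂, so its left
  -- difference quotients are nonnegative, against `htouch`.
  have : 0 ≤ φ' v T₂ - h' T₂ := by
    refine ge_of_tendsto hd ?_
    filter_upwards [self_mem_nhdsWithin] with t ht
    have h1 := hbelow t ht v hv
    rw [slope_def_field]
    apply div_nonneg_of_nonpos
    · simp only [Pi.sub_apply, heq]; linarith
    · linarith [ht.2]
  linarith

variable {p : Type*} [Fintype p]

theorem isCompact_unitSphere : IsCompact {v : p → ℝ | v ⬝ᵥ v = 1} := by
  apply Metric.isCompact_of_isClosed_isBounded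
  · exact isClosed_eq (by simp only [dotProduct]; fun_prop) continuous_const
  · refine (Metric.isBounded_closedBall (x := (0 : p → ℝ)) (r := 1)).subset fun v hv => ?_
    rw [mem_closedBall_zero_iff, pi_norm_le_iff_of_nonneg zero_le_one]
    intro i
    have h : v i * v i ≤ v ⬝ᵥ v :=
      Finset.single_le_sum (f := fun i => v i * v i) (fun i _ => mul_self_nonneg _)
        (Finset.mem_univ i)
    rw [show v ⬝ᵥ v = 1 from hv] at h
    rw [Real.norm_eq_abs]
    exact abs_le_of_sq_le_sq (by nlinarith) zero_le_one

theorem symBound_of_unit {g : ℝ} {E : Matrix p p ℝ}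
    (h : ∀ v : p → ℝ, v ⬝ᵥ v = 1 → |v ⬝ᵥ E *ᵥ v| ≤ g) : SymBound g E := by
  intro v
  rcases (dotProduct_self_nonneg' v).lt_or_eq with hv | hv
  · have h1 := h ((Real.sqrt (v ⬝ᵥ v))⁻¹ • v) (by
      rw [smul_dotProduct, dotProduct_smul, smul_eq_mul, smul_eq_mul, ← mul_assoc, ← mul_inv,
        Real.mul_self_sqrt hv.le, inv_mul_cancel₀ hv.ne'])
    rw [mulVec_smul, smul_dotProduct, dotProduct_smul, smul_eq_mul, smul_eq_mul, ← mul_assoc,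
      ← mul_inv, Real.mul_self_sqrt hv.le, abs_mul, abs_of_pos (inv_pos.2 hv),
      inv_mul_le_iff₀ hv] at h1
    linarith
  · have : v = 0 := by simpa using hv.symm
    simp [this]

/-- If the quadratic form of a symmetric matrix attains its extreme value at `v`, then `v` is an
eigenvector. -/
theorem SymBound.mulVec_eq {g σ : ℝ} {E : Matrix p p ℝ} (hE : SymBound g E) (hs : E.IsSymm)
    (hσ : σ ^ 2 = 1) {v : p → ℝ} (hv : v ⬝ᵥ v = 1) (h : σ * (v ⬝ᵥ E *ᵥ v) = g) :
    E *ᵥ v = (σ * g) • v := by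
  classical
  have hpsd : (g • (1 : Matrix p p ℝ) - σ • E).PosSemidef := by
    refine PosSemidef.of_dotProduct_mulVec_nonneg ?_ fun x => ?_
    · rw [IsHermitian, conjTranspose_eq_transpose_of_trivial]
      simp [hs.eq]
    · rw [sub_mulVec, smul_mulVec, smul_mulVec, one_mulVec]
      simp only [star_trivial, dotProduct_sub, dotProduct_smul, smul_eq_mul]
      have h1 := abs_le.1 (hE x)
      rcases sq_eq_sq_iff_eq_or_eq_neg.1 (hσ.trans (one_pow 2).symm) with h | h <;> subst h <;> linarith
  have h0 := (hpsd.dotProduct_mulVec_zero_iff v).1 (by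
    rw [sub_mulVec, smul_mulVec, smul_mulVec, one_mulVec]
    simp only [star_trivial, dotProduct_sub, dotProduct_smul, smul_eq_mul]
    rw [h, hv]; ring)
  rw [sub_mulVec, smul_mulVec, smul_mulVec, one_mulVec, sub_eq_zero] at h0
  rw [mul_smul, h0, smul_smul, ← sq, hσ, one_smul]

/-- First-touching-time argument for the extreme eigenvalues of a curve of symmetric matrices. -/
theorem symBound_of_barrier {Z Z' : ℝ → Matrix p p ℝ} {h h' : ℝ → ℝ} {T c : ℝ}
    (hsymm : ∀ t ∈ Icc 0 T, (Z t).IsSymm)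
    (hZ : ∀ t ∈ Icc 0 T, HasEntryDeriv Z (Z' t) (Ici 0) t)
    (hh : ∀ t ∈ Icc 0 T, HasDerivWithinAt h (h' t) (Ici 0) t)
    (h0 : SymBound c (Z 0)) (hc : c < h 0)
    (htouch : ∀ t ∈ Icc 0 T, SymBound (h t) (Z t) → ∀ σ : ℝ, σ ^ 2 = 1 → ∀ v : p → ℝ,
      v ⬝ᵥ v = 1 → Z t *ᵥ v = (σ * h t) • v → σ * (v ⬝ᵥ Z' t *ᵥ v) < h' t) :
    ∀ t ∈ Icc 0 T, SymBound (h t) (Z t) := by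
  -- The sign in the index set treats the largest and the smallest eigenvalue as one family.
  have hK : IsCompact (({1, -1} : Set ℝ) ×ˢ {v : p → ℝ | v ⬝ᵥ v = 1}) :=
    (Set.toFinite _).isCompact.prod isCompact_unitSphere
  have hbd : ∀ t, (∀ w ∈ ({1, -1} : Set ℝ) ×ˢ {v : p → ℝ | v ⬝ᵥ v = 1},
      w.1 * (w.2 ⬝ᵥ Z t *ᵥ w.2) ≤ h t) → SymBound (h t) (Z t) := by
    intro t ht
    refine symBound_of_unit fun v hv => abs_le.2 ⟨?_, ?_⟩
    · have := ht (-1, v) ⟨by simp, hv⟩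
      simp only at this
      linarith
    · have := ht (1, v) ⟨by simp, hv⟩
      simp only at this
      linarith
  have hsq : ∀ σ ∈ ({1, -1} : Set ℝ), σ ^ 2 = 1 := by
    rintro σ (rfl | rfl) <;> norm_num
  have key := le_of_barrier hK (φ := fun w t => w.1 * (w.2 ⬝ᵥ Z t *ᵥ w.2))
    (φ' := fun w t => w.1 * (w.2 ⬝ᵥ Z' t *ᵥ w.2)) (h := h) (h' := h') (T := T) ?_ ?_ hh ?_ ?_
  · exact fun t ht => hbd t (key t ht)
  · have hZc : ∀ a b, ContinuousOn (fun t => Z t a b) (Icc 0 T) := fun a b t ht =>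
      (hZ t ht a b).continuousWithinAt.mono Icc_subset_Ici_self
    have hZc' : ∀ a b, ContinuousOn (fun z : (ℝ × (p → ℝ)) × ℝ => Z z.2 a b)
        ((({1, -1} : Set ℝ) ×ˢ {v : p → ℝ | v ⬝ᵥ v = 1}) ×ˢ Icc 0 T) := fun a b =>
      (hZc a b).comp continuousOn_snd fun z hz => hz.2
    simp only [dotProduct, mulVec]
    refine ContinuousOn.mul (by fun_prop) (continuousOn_finsetSum _ fun a _ =>
      ContinuousOn.mul (by fun_prop) (continuousOn_finsetSum _ fun b _ =>
        ContinuousOn.mul (hZc' a b) (by fun_prop)))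
  · exact fun w _ t ht => ((hZ t ht).dotProduct w.2 w.2).const_mul w.1
  · rintro ⟨σ, v⟩ ⟨hσ, hv⟩
    have h1 := abs_le.1 (h0 v)
    rw [show v ⬝ᵥ v = 1 from hv] at h1
    rcases hσ with rfl | rfl <;> simp only <;> linarith
  · rintro t ht hall ⟨σ, v⟩ ⟨hσ, hv⟩ heq
    exact htouch t ht (hbd t hall) σ (hsq σ hσ) v hv
      ((hbd t hall).mulVec_eq (hsymm t ht) (hsq σ hσ) hv heq)

end Barrier

end OperatorScaling

/-! ### Evolution of the size, the errors and Δ along the flow. -/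

namespace OperatorScaling

open Matrix Set

variable {m n k : ℕ}

/-- `X` solves the gradient flow equation for all times `t ≥ 0`. -/
def IsFlow (X : ℝ → Fin k → Matrix (Fin m) (Fin n) ℝ) : Prop :=
  ∀ t ∈ Ici (0 : ℝ), ∀ i, HasEntryDeriv (fun τ => X τ i) (field (X t) i) (Ici 0) t

theorem IsGradientFlow.isFlow {A : Fin k → Matrix (Fin m) (Fin n) ℝ}
    {X : ℝ → Fin k → Matrix (Fin m) (Fin n) ℝ} (h : IsGradientFlow A X) : IsFlow X :=
  fun t ht i => h.2 t ht i

section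

variable {X : ℝ → Fin k → Matrix (Fin m) (Fin n) ℝ} {Y : Fin k → Matrix (Fin m) (Fin n) ℝ}
  {s : Set ℝ} {t : ℝ}

theorem hasEntryDeriv_leftMarginal
    (h : ∀ i, HasEntryDeriv (fun τ => X τ i) (Y i) s t) :
    HasEntryDeriv (fun τ => leftMarginal (X τ)) (∑ i, (Y i * (X t i)ᵀ + X t i * (Y i)ᵀ)) s t :=
  HasEntryDeriv.sum fun i => (h i).mul (h i).transpose

theorem hasDerivWithinAt_size
    (h : ∀ i, HasEntryDeriv (fun τ => X τ i) (Y i) s t) :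
    HasDerivWithinAt (fun τ => size (X τ)) (trace (∑ i, (Y i * (X t i)ᵀ + X t i * (Y i)ᵀ))) s t := by
  have := (hasEntryDeriv_leftMarginal h).trace
  simpa only [trace_leftMarginal] using this

theorem IsFlow.transpose (h : IsFlow X) : IsFlow (fun t => transposeOp (X t)) := by
  intro t ht i
  rw [field_transposeOp]
  exact (h t ht i).transpose

theorem IsFlow.leftMarginal (h : IsFlow X) (ht : t ∈ Ici (0 : ℝ)) :
    HasEntryDeriv (fun τ => leftMarginal (X τ)) (leftMarginalDeriv (X t)) (Ici 0) t :=
  hasEntryDeriv_leftMarginal (h t ht)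

theorem IsFlow.size (h : IsFlow X) (hm : m ≠ 0) (hn : n ≠ 0) (ht : t ∈ Ici (0 : ℝ)) :
    HasDerivWithinAt (fun τ => size (X τ)) (-2 * delta (X t)) (Ici 0) t := by
  rw [← trace_leftMarginalDeriv (X t) hm hn]
  exact hasDerivWithinAt_size (h t ht)

theorem IsFlow.errL (h : IsFlow X) (hm : m ≠ 0) (hn : n ≠ 0) (ht : t ∈ Ici (0 : ℝ)) :
    HasEntryDeriv (fun τ => errL (X τ)) (errLDeriv (X t)) (Ici 0) t :=
  (HasEntryDeriv.smul_const (h.size hm hn ht) 1).sub ((h.leftMarginal ht).const_smul _)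

theorem IsFlow.errR (h : IsFlow X) (hm : m ≠ 0) (hn : n ≠ 0) (ht : t ∈ Ici (0 : ℝ)) :
    HasEntryDeriv (fun τ => errR (X τ)) (errLDeriv (transposeOp (X t))) (Ici 0) t := by
  have := h.transpose.errL hn hm ht
  simpa only [errL_transposeOp] using this

theorem trace_errL_mul_errLDeriv (A : Fin k → Matrix (Fin m) (Fin n) ℝ) :
    trace (errL A * errLDeriv A) = -(m * trace (errL A * leftMarginalDeriv A)) := by
  simp [errLDeriv, Matrix.mul_sub, trace_errL]

theorem IsFlow.delta (h : IsFlow X) (hm : m ≠ 0) (hn : n ≠ 0) (ht : t ∈ Ici (0 : ℝ)) :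
    HasDerivWithinAt (fun τ => delta (X τ)) (-4 * ∑ i, fsq (field (X t) i)) (Ici 0) t := by
  have hm' : (m : ℝ) ≠ 0 := by exact_mod_cast hm
  have hn' : (n : ℝ) ≠ 0 := by exact_mod_cast hn
  have h1 := ((h.errL hm hn ht).fsq.const_mul (1 / (m : ℝ))).add
    ((h.errR hm hn ht).fsq.const_mul (1 / (n : ℝ)))
  refine h1.congr_deriv ?_
  have h2 := trace_errL_mul_errLDeriv (X t)
  have h3 := trace_errL_mul_errLDeriv (transposeOp (X t))
  rw [errL_transposeOp] at h3
  rw [(isSymm_errL _).eq, (isSymm_errR _).eq, h2, h3]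
  have h4 := trace_mul_derivs (X t)
  field_simp
  linarith

/-- Cyclicity of the trace moves the error factors of the field onto the arguments: E multiplies U
from either side, and F multiplies V. -/
theorem IsFlow.bil (h : IsFlow X) (ht : t ∈ Ici (0 : ℝ)) (U : Matrix (Fin m) (Fin m) ℝ)
    (V : Matrix (Fin n) (Fin n) ℝ) :
    HasDerivWithinAt (fun τ => bil (X τ) U V)
      (bil (X t) (OperatorScaling.errL (X t) * U) V + bil (X t) (U * OperatorScaling.errL (X t)) V
        + bil (X t) U (OperatorScaling.errR (X t) * V)
        + bil (X t) U (V * OperatorScaling.errR (X t))) (Ici 0) t := by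
  have h1 : ∀ i, HasDerivWithinAt (fun τ => trace (Uᵀ * X τ i * V * (X τ i)ᵀ)) _ (Ici 0) t :=
    fun i => ((((hasEntryDeriv_const Uᵀ).mul (h t ht i)).mul (hasEntryDeriv_const V)).mul
      (h t ht i).transpose).trace
  have h2 := HasDerivWithinAt.fun_sum (u := Finset.univ) fun i _ => h1 i
  refine h2.congr_deriv ?_
  simp only [OperatorScaling.bil, ← Finset.sum_add_distrib]
  refine Finset.sum_congr rfl fun i _ => ?_
  simp only [field, transpose_mul, transpose_add, (isSymm_errL (X t)).eq, (isSymm_errR (X t)).eq,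
    Matrix.zero_mul, Matrix.mul_zero, zero_add, add_zero, Matrix.mul_add, Matrix.add_mul,
    trace_add]
  have e1 : trace (Uᵀ * X t i * V * ((X t i)ᵀ * OperatorScaling.errL (X t))) =
      trace (OperatorScaling.errL (X t) * Uᵀ * X t i * V * (X t i)ᵀ) := by
    rw [← Matrix.mul_assoc, trace_mul_comm]
    simp only [Matrix.mul_assoc]
  rw [e1]
  simp only [Matrix.mul_assoc]
  ring

theorem IsFlow.antitoneOn_size (h : IsFlow X) (hm : m ≠ 0) (hn : n ≠ 0) :
    AntitoneOn (fun τ => OperatorScaling.size (X τ)) (Ici 0) := by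
  refine antitoneOn_of_hasDerivWithinAt_nonpos (convex_Ici 0)
    (fun t ht => (h.size hm hn ht).continuousWithinAt)
    (fun t ht => (h.size hm hn (interior_subset ht)).mono interior_subset) fun t _ => ?_
  have := delta_nonneg (X t)
  linarith

theorem IsFlow.antitoneOn_delta (h : IsFlow X) (hm : m ≠ 0) (hn : n ≠ 0) :
    AntitoneOn (fun τ => OperatorScaling.delta (X τ)) (Ici 0) := by
  refine antitoneOn_of_hasDerivWithinAt_nonpos (convex_Ici 0)
    (fun t ht => (h.delta hm hn ht).continuousWithinAt)
    (fun t ht => (h.delta hm hn (interior_subset ht)).mono interior_subset) fun t _ => ?_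
  have : 0 ≤ ∑ i, fsq (field (X t) i) := Finset.sum_nonneg fun i _ => fsq_nonneg _
  linarith

end

section Blocks

variable {p q : Type*} [Fintype p] [Fintype q]

theorem symBound_fromBlocks {g : ℝ} {E : Matrix p p ℝ} {F : Matrix q q ℝ} :
    SymBound g (fromBlocks E 0 0 F) ↔ SymBound g E ∧ SymBound g F := by
  constructor
  · intro h
    constructor
    · intro v
      have := h (Sum.elim v 0)
      simpa [fromBlocks_mulVec, sumElim_dotProduct_sumElim] using this
    · intro v
      have := h (Sum.elim 0 v)
      simpa [fromBlocks_mulVec, sumElim_dotProduct_sumElim] using this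
  · rintro ⟨hE, hF⟩ v
    obtain ⟨x, y, rfl⟩ : ∃ x y, v = Sum.elim x y := ⟨v ∘ Sum.inl, v ∘ Sum.inr, by simp⟩
    simp only [fromBlocks_mulVec, Sum.elim_comp_inl, Sum.elim_comp_inr, zero_mulVec, add_zero,
      zero_add, sumElim_dotProduct_sumElim, mul_add]
    exact (abs_add_le _ _).trans (add_le_add (hE x) (hF y))

end Blocks

/-- The error matrices can only grow by as much as the size decreases. -/
theorem IsFlow.symBound {X : ℝ → Fin k → Matrix (Fin m) (Fin n) ℝ} (h : IsFlow X)
    (hm : m ≠ 0) (hn : n ≠ 0) {c : ℝ} (hL : SymBound c (OperatorScaling.errL (X 0)))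
    (hR : SymBound c (OperatorScaling.errR (X 0))) {t : ℝ} (ht : t ∈ Ici (0 : ℝ)) :
    SymBound (c + (OperatorScaling.size (X 0) - OperatorScaling.size (X t)))
        (OperatorScaling.errL (X t)) ∧
      SymBound (c + (OperatorScaling.size (X 0) - OperatorScaling.size (X t)))
        (OperatorScaling.errR (X t)) := by
  -- Both errors are put into one block-diagonal matrix with a common barrier H. At a touching
  -- eigenvector the damping 2H(s ∓ H) cancels exactly against the forcing by the other block,
  -- leaving at most 2Δ, the speed at which s decreases. The slack δ(1 + τ) makes the comparison
  -- strict and is removed at the end.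
  have key : ∀ δ > 0, SymBound
      (c + (OperatorScaling.size (X 0) - OperatorScaling.size (X t)) + δ * (1 + t))
      (fromBlocks (OperatorScaling.errL (X t)) 0 0 (OperatorScaling.errR (X t))) := by
    intro δ hδ
    refine symBound_of_barrier (T := t) (c := c)
      (Z := fun τ => fromBlocks (OperatorScaling.errL (X τ)) 0 0 (OperatorScaling.errR (X τ)))
      (Z' := fun τ => fromBlocks (errLDeriv (X τ)) 0 0 (errLDeriv (transposeOp (X τ))))
      (h := fun τ => c + (OperatorScaling.size (X 0) - OperatorScaling.size (X τ)) + δ * (1 + τ))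
      (h' := fun τ => 2 * OperatorScaling.delta (X τ) + δ)
      ?_ ?_ ?_ ?_ ?_ ?_ t ⟨ht, le_rfl⟩
    · intro τ _
      simp [Matrix.IsSymm, fromBlocks_transpose, (isSymm_errL _).eq, (isSymm_errR _).eq]
    · rintro τ hτ (a | a) (b | b)
      · exact h.errL hm hn hτ.1 a b
      · exact hasDerivWithinAt_const _ _ _
      · exact hasDerivWithinAt_const _ _ _
      · exact h.errR hm hn hτ.1 a b
    · intro τ hτ
      have := (((h.size hm hn hτ.1).const_sub (OperatorScaling.size (X 0))).const_add c).add
        (((hasDerivWithinAt_id τ (Ici 0)).const_add 1).const_mul δ)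
      refine this.congr_deriv ?_
      ring
    · exact symBound_fromBlocks.2 ⟨hL, hR⟩
    · linarith
    · intro τ hτ hb σ hσ v hv hev
      obtain ⟨x, y, rfl⟩ : ∃ x y, v = Sum.elim x y := ⟨v ∘ Sum.inl, v ∘ Sum.inr, by simp⟩
      obtain ⟨hbL, hbR⟩ := symBound_fromBlocks.1 hb
      set H := c + (OperatorScaling.size (X 0) - OperatorScaling.size (X τ)) + δ * (1 + τ) with hH
      simp only [fromBlocks_mulVec, Sum.elim_comp_inl, Sum.elim_comp_inr, zero_mulVec, add_zero,
        zero_add, sumElim_dotProduct_sumElim] at hev hv ⊢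
      have hx : OperatorScaling.errL (X τ) *ᵥ x = (σ * H) • x :=
        funext fun i => congrFun hev (Sum.inl i)
      have hy : OperatorScaling.errR (X τ) *ᵥ y = (σ * H) • y :=
        funext fun i => congrFun hev (Sum.inr i)
      have h1 := abs_dotProduct_errLDeriv_le (X τ) hbR x hx
      have h2 := abs_dotProduct_errLDeriv_le (transposeOp (X τ))
        (by rwa [errR_transposeOp]) y (by rwa [errL_transposeOp])
      rw [size_transposeOp, delta_transposeOp] at h2
      have hx0 := dotProduct_self_nonneg' x
      have hy0 := dotProduct_self_nonneg' y
      have hd := delta_nonneg (X τ)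
      have h1' := abs_le.1 h1
      have h2' := abs_le.1 h2
      have hdx := mul_nonneg hd hx0
      have hdy := mul_nonneg hd hy0
      have hfin : 2 * OperatorScaling.delta (X τ) * (x ⬝ᵥ x) +
          2 * OperatorScaling.delta (X τ) * (y ⬝ᵥ y) = 2 * OperatorScaling.delta (X τ) := by
        rw [← mul_add, hv, mul_one]
      rcases sq_eq_sq_iff_eq_or_eq_neg.1 (hσ.trans (one_pow 2).symm) with rfl | rfl
      · linarith [h1'.2, h2'.2]
      · linarith [h1'.1, h2'.1]
  have ht' : (0 : ℝ) ≤ t := ht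
  have lim : SymBound (c + (OperatorScaling.size (X 0) - OperatorScaling.size (X t)))
      (fromBlocks (OperatorScaling.errL (X t)) 0 0 (OperatorScaling.errR (X t))) := by
    intro v
    refine le_of_forall_pos_le_add fun η hη => ?_
    have h0 := dotProduct_self_nonneg' v
    have hpos : 0 < (1 + t) * (v ⬝ᵥ v + 1) := by positivity
    have h1 := key (η / ((1 + t) * (v ⬝ᵥ v + 1))) (by positivity) v
    have h2 : η / ((1 + t) * (v ⬝ᵥ v + 1)) * (1 + t) * (v ⬝ᵥ v) ≤ η := by
      rw [div_mul_eq_mul_div, div_mul_eq_mul_div, div_le_iff₀ hpos]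
      nlinarith [mul_nonneg hη.le (by positivity : 0 ≤ 1 + t)]
    rw [add_mul] at h1
    linarith
  exact symBound_fromBlocks.1 lim

end OperatorScaling

/-! ### Drift of the bilinear form, and damping of the right error. -/

namespace OperatorScaling

open Matrix Set

variable {m n k : ℕ}

theorem abs_bil_le {A : Fin k → Matrix (Fin m) (Fin n) ℝ} (hm : 0 < m) (hn : 0 < n) {g : ℝ}
    (hg : 0 ≤ g) (hL : SymBound g (errL A)) (hR : SymBound g (errR A))
    (U : Matrix (Fin m) (Fin m) ℝ) (V : Matrix (Fin n) (Fin n) ℝ) :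
    |bil A U V| ≤ (size A + g) / √(m * n) * √(fsq U * fsq V) := by
  have hm' : (0 : ℝ) < m := by exact_mod_cast hm
  have hn' : (0 : ℝ) < n := by exact_mod_cast hn
  have h := mul_bil_sq_le A hL hR U V
  have hs := size_nonneg A
  have hU := fsq_nonneg U
  have hV := fsq_nonneg V
  apply abs_le_of_sq_le_sq _ (by positivity)
  rw [mul_pow, div_pow, Real.sq_sqrt (by positivity), Real.sq_sqrt (by positivity),
    div_mul_eq_mul_div, le_div_iff₀ (by positivity)]
  linarith

theorem sqrt_mul_le_of_le {x y z g : ℝ} (hg : 0 ≤ g) (h : z ≤ g ^ 2 * x) (hy : 0 ≤ y) :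
    √(z * y) ≤ g * √(x * y) := by
  rw [← Real.sqrt_sq hg, ← Real.sqrt_mul (sq_nonneg g)]
  refine Real.sqrt_le_sqrt ?_
  rw [← mul_assoc]
  gcongr

/-- The derivative consists of four values of the form, each with one argument multiplied by an
error of norm at most H. The trivial bound applies to each, so the drift is controlled by the
integral of H. -/
theorem IsFlow.abs_bil_sub_le {X : ℝ → Fin k → Matrix (Fin m) (Fin n) ℝ} (h : IsFlow X)
    (hm : 0 < m) (hn : 0 < n) {T N : ℝ} {H G : ℝ → ℝ} (hT : 0 ≤ T)
    (hG : ∀ t ∈ Icc 0 T, HasDerivWithinAt G (H t) (Ici 0) t)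
    (hH : ∀ t ∈ Icc 0 T, 0 < H t) (hN : ∀ t ∈ Icc 0 T, OperatorScaling.size (X t) + H t ≤ N)
    (hL : ∀ t ∈ Icc 0 T, SymBound (H t) (OperatorScaling.errL (X t)))
    (hR : ∀ t ∈ Icc 0 T, SymBound (H t) (OperatorScaling.errR (X t)))
    (U : Matrix (Fin m) (Fin m) ℝ) (V : Matrix (Fin n) (Fin n) ℝ) :
    |OperatorScaling.bil (X T) U V - OperatorScaling.bil (X 0) U V| ≤
      4 * (N / √(m * n) * √(fsq U * fsq V)) * (G T - G 0) := by
  set c := 4 * (N / √(m * n) * √(fsq U * fsq V)) with hc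
  have hU := fsq_nonneg U
  have hV := fsq_nonneg V
  have hder : ∀ t ∈ Icc 0 T,
      |OperatorScaling.bil (X t) (OperatorScaling.errL (X t) * U) V +
        OperatorScaling.bil (X t) (U * OperatorScaling.errL (X t)) V
        + OperatorScaling.bil (X t) U (OperatorScaling.errR (X t) * V)
        + OperatorScaling.bil (X t) U (V * OperatorScaling.errR (X t))| ≤ c * H t := by
    intro t ht
    have hHt := hH t ht
    have hb : ∀ U' V', √(fsq U' * fsq V') ≤ H t * √(fsq U * fsq V) →
        |OperatorScaling.bil (X t) U' V'| ≤ N / √(m * n) * (H t * √(fsq U * fsq V)) := by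
      intro U' V' hUV
      refine (abs_bil_le hm hn hHt.le (hL t ht) (hR t ht) U' V').trans ?_
      have := hN t ht
      have := size_nonneg (X t)
      have : 0 ≤ N := by linarith
      gcongr
    have b1 := hb (OperatorScaling.errL (X t) * U) V
      (sqrt_mul_le_of_le hHt.le ((hL t ht).fsq_mul_le (isSymm_errL _) hHt U) hV)
    have b2 := hb (U * OperatorScaling.errL (X t)) V
      (sqrt_mul_le_of_le hHt.le ((hL t ht).fsq_mul_le' (isSymm_errL _) hHt U) hV)
    have b3 := hb U (OperatorScaling.errR (X t) * V) (by
      rw [mul_comm (fsq U), mul_comm (fsq U)]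
      exact sqrt_mul_le_of_le hHt.le ((hR t ht).fsq_mul_le (isSymm_errR _) hHt V) hU)
    have b4 := hb U (V * OperatorScaling.errR (X t)) (by
      rw [mul_comm (fsq U), mul_comm (fsq U)]
      exact sqrt_mul_le_of_le hHt.le ((hR t ht).fsq_mul_le' (isSymm_errR _) hHt V) hU)
    have e : c * H t = 4 * (N / √(m * n) * (H t * √(fsq U * fsq V))) := by rw [hc]; ring
    rw [e]
    rw [abs_le] at *
    constructor <;> linarith [b1.1, b1.2, b2.1, b2.2, b3.1, b3.2, b4.1, b4.2]
  have hcont : ContinuousOn (fun t => OperatorScaling.bil (X t) U V) (Icc 0 T) := fun t ht =>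
    (h.bil ht.1 U V).continuousWithinAt.mono Icc_subset_Ici_self
  have hGc : ContinuousOn G (Icc 0 T) := fun t ht =>
    (hG t ht).continuousWithinAt.mono Icc_subset_Ici_self
  have hsub : ∀ t ∈ Ico 0 T, Ici t ⊆ Ici (0 : ℝ) := fun t ht => Ici_subset_Ici.2 ht.1
  have hmem : ∀ t ∈ Ico 0 T, t ∈ Icc 0 T := fun t ht => Ico_subset_Icc_self ht
  rw [abs_le]
  constructor
  · have := image_le_of_deriv_right_le_deriv_boundary
      (f := fun t => -OperatorScaling.bil (X t) U V)
      (B := fun t => c * (G t - G 0) - OperatorScaling.bil (X 0) U V) hcont.neg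
      (fun t ht => ((h.bil ht.1 U V).mono (hsub t ht)).neg) (by simp)
      ((continuousOn_const.mul (hGc.sub continuousOn_const)).sub continuousOn_const)
      (fun t ht => ((((hG t (hmem t ht)).mono (hsub t ht)).sub_const (G 0)).const_mul c).sub_const _)
      (fun t ht => neg_le.1 (abs_le.1 (hder t (hmem t ht))).1) (right_mem_Icc.2 hT)
    linarith
  · have := image_le_of_deriv_right_le_deriv_boundary
      (f := fun t => OperatorScaling.bil (X t) U V)
      (B := fun t => c * (G t - G 0) + OperatorScaling.bil (X 0) U V) hcont
      (fun t ht => ((h.bil ht.1 U V).mono (hsub t ht))) (by simp)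
      ((continuousOn_const.mul (hGc.sub continuousOn_const)).add continuousOn_const)
      (fun t ht => ((((hG t (hmem t ht)).mono (hsub t ht)).sub_const (G 0)).const_mul c).add_const _)
      (fun t ht => (abs_le.1 (hder t (hmem t ht))).2) (right_mem_Icc.2 hT)
    linarith

/-- The right error is damped at a rate of order the size, and driven only by the left error. -/
theorem IsFlow.symBound_errR {X : ℝ → Fin k → Matrix (Fin m) (Fin n) ℝ} (h : IsFlow X)
    (hm : m ≠ 0) (hn : n ≠ 0) {T c : ℝ} {e H H' : ℝ → ℝ}
    (hE : ∀ t ∈ Icc 0 T, SymBound (e t) (OperatorScaling.errL (X t)))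
    (hH : ∀ t ∈ Icc 0 T, HasDerivWithinAt H (H' t) (Ici 0) t)
    (h0 : SymBound c (OperatorScaling.errR (X 0))) (hc : c < H 0)
    (hpos : ∀ t ∈ Icc 0 T, 0 ≤ H t) (heH : ∀ t ∈ Icc 0 T, e t ≤ H t)
    (hlt : ∀ t ∈ Icc 0 T, 2 * OperatorScaling.delta (X t) -
      2 * (OperatorScaling.size (X t) - H t) * (H t - e t) < H' t) :
    ∀ t ∈ Icc 0 T, SymBound (H t) (OperatorScaling.errR (X t)) := by
  refine symBound_of_barrier (fun t _ => isSymm_errR _) (fun t ht => h.errR hm hn ht.1) hH h0 hc ?_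
  intro t ht _ σ hσ v hv hev
  have h1 := abs_dotProduct_errLDeriv_le (transposeOp (X t)) (f := e t)
    (by rw [errR_transposeOp]; exact hE t ht) v (by rwa [errL_transposeOp])
  rw [size_transposeOp, delta_transposeOp, hv] at h1
  have h1' := abs_le.1 h1
  have h2 := hlt t ht
  have hd := delta_nonneg (X t)
  -- At the negative extreme the damping factor is s + H instead of s - H; since 0 ≤ H and e ≤ H
  -- this is only better, so the same inequality suffices.
  rcases sq_eq_sq_iff_eq_or_eq_neg.1 (hσ.trans (one_pow 2).symm) with rfl | rfl
  · nlinarith [h1'.2]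
  · nlinarith [h1'.1, mul_nonneg (hpos t ht) (sub_nonneg.2 (heH t ht))]

theorem fsq_one {p : Type*} [Fintype p] [DecidableEq p] :
    fsq (1 : Matrix p p ℝ) = Fintype.card p := by
  rw [fsq_eq_trace]; simp

theorem delta_le_of_symBound {A : Fin k → Matrix (Fin m) (Fin n) ℝ} (hm : 0 < m) (hn : 0 < n)
    {g : ℝ} (hg : 0 < g) (hL : SymBound g (errL A)) (hR : SymBound g (errR A)) :
    delta A ≤ 2 * g ^ 2 := by
  have hm' : (0 : ℝ) < m := by exact_mod_cast hm
  have hn' : (0 : ℝ) < n := by exact_mod_cast hn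
  have h1 := hL.fsq_mul_le (isSymm_errL A) hg (1 : Matrix (Fin m) (Fin m) ℝ)
  have h2 := hR.fsq_mul_le (isSymm_errR A) hg (1 : Matrix (Fin n) (Fin n) ℝ)
  rw [Matrix.mul_one, fsq_one, Fintype.card_fin] at h1 h2
  rw [delta, frobSq_eq_fsq, frobSq_eq_fsq]
  have h3 : 1 / (m : ℝ) * fsq (errL A) ≤ g ^ 2 := by
    rw [div_mul_eq_mul_div, one_mul, div_le_iff₀ hm']; exact h1
  have h4 : 1 / (n : ℝ) * fsq (errR A) ≤ g ^ 2 := by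
    rw [div_mul_eq_mul_div, one_mul, div_le_iff₀ hn']; exact h2
  linarith

/-- Only the term of weight 1/m is kept. This loss of √m in norm is the source of the log m. -/
theorem fsq_errL_le {A : Fin k → Matrix (Fin m) (Fin n) ℝ} (hm : 0 < m) :
    fsq (errL A) ≤ m * delta A := by
  have hm' : (0 : ℝ) < m := by exact_mod_cast hm
  have h2 := fsq_nonneg (errR A)
  have : fsq (errL A) = m * (1 / m * fsq (errL A)) := by field_simp
  rw [this, delta, frobSq_eq_fsq, frobSq_eq_fsq]
  gcongr
  have : 0 ≤ 1 / (n : ℝ) * fsq (errR A) := by positivity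
  linarith

end OperatorScaling

namespace OperatorScaling

open Matrix Set

variable {m n k : ℕ}

/-! ### The scalar comparison function and its integral. -/

section ErrorBound

/-- `√(2m) e^{-μt}`, which is one at the time when the Frobenius bound takes over. -/
noncomputable def decay (m : ℕ) (μ t : ℝ) : ℝ := √(2 * m) * Real.exp (-(μ * t))

/-- A bound for the error matrices which is constant at first and then decays exponentially. -/
noncomputable def errorBound (m : ℕ) (g μ t : ℝ) : ℝ :=
  12 * g * (decay m μ t / (1 + decay m μ t))

/-- An antiderivative of `errorBound`. -/
noncomputable def errorBoundInt (m : ℕ) (g μ t : ℝ) : ℝ :=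
  -(12 * g / μ) * Real.log (1 + decay m μ t)

variable {g μ : ℝ}

theorem decay_pos (hm : 0 < m) (t : ℝ) : 0 < decay m μ t := by
  have : (0 : ℝ) < m := by exact_mod_cast hm
  unfold decay; positivity

theorem hasDerivAt_decay (t : ℝ) : HasDerivAt (decay m μ) (-μ * decay m μ t) t := by
  have h : HasDerivAt (fun t => -(μ * t)) (-(μ * 1)) t := ((hasDerivAt_id t).const_mul μ).neg
  refine (h.exp.const_mul (√(2 * m))).congr_deriv ?_
  rw [decay]; ring

theorem hasDerivAt_errorBound (hm : 0 < m) (t : ℝ) :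
    HasDerivAt (errorBound m g μ)
      (-(12 * g * (μ * (decay m μ t / (1 + decay m μ t) ^ 2)))) t := by
  have hy := decay_pos (μ := μ) hm t
  have h := hasDerivAt_decay (m := m) (μ := μ) t
  refine ((h.div (h.const_add 1) (by positivity)).const_mul (12 * g)).congr_deriv ?_
  field_simp
  ring

theorem hasDerivAt_errorBoundInt (hm : 0 < m) (hμ : μ ≠ 0) (t : ℝ) :
    HasDerivAt (errorBoundInt m g μ) (errorBound m g μ t) t := by
  have hy := decay_pos (μ := μ) hm t
  have h := hasDerivAt_decay (m := m) (μ := μ) t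
  refine (((h.const_add 1).log (by positivity)).const_mul (-(12 * g / μ))).congr_deriv ?_
  rw [errorBound]
  field_simp

theorem errorBound_pos (hm : 0 < m) (hg : 0 < g) (t : ℝ) : 0 < errorBound m g μ t := by
  have hy := decay_pos (μ := μ) hm t
  unfold errorBound; positivity

theorem errorBound_lt (hm : 0 < m) (hg : 0 < g) (t : ℝ) : errorBound m g μ t < 12 * g := by
  have hy := decay_pos (μ := μ) hm t
  unfold errorBound
  have : decay m μ t / (1 + decay m μ t) < 1 := by rw [div_lt_one (by positivity)]; linarith
  nlinarith

theorem errorBound_le_decay (hm : 0 < m) (hg : 0 < g) (t : ℝ) :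
    errorBound m g μ t ≤ 12 * g * decay m μ t := by
  have hy := decay_pos (μ := μ) hm t
  unfold errorBound
  gcongr
  exact div_le_self hy.le (by linarith)

theorem two_le_sqrt (hm : 2 ≤ m) : 2 ≤ √(2 * m) := by
  have : (2 : ℝ) ≤ m := by exact_mod_cast hm
  apply Real.le_sqrt_of_sq_le
  linarith

/-- The logarithmic derivative is -μ/(1 + y) with y = `decay m μ t`; the bound thus never falls
faster than at rate μ, slowly enough for the damped right error to follow. -/
theorem neg_le_deriv_errorBound (hm : 0 < m) (hg : 0 < g) (hμ : 0 < μ) (t : ℝ) :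
    -(μ * errorBound m g μ t) ≤ -(12 * g * (μ * (decay m μ t / (1 + decay m μ t) ^ 2))) := by
  have hy := decay_pos (μ := μ) hm t
  rw [errorBound, neg_le_neg_iff]
  have : decay m μ t / (1 + decay m μ t) ^ 2 ≤ decay m μ t / (1 + decay m μ t) := by
    gcongr
    nlinarith
  calc _ ≤ 12 * g * (μ * (decay m μ t / (1 + decay m μ t))) := by gcongr
    _ = _ := by ring

/-- The error bound controls both of the elementary bounds for the left error. -/
theorem le_errorBound {x : ℝ} (hm : 0 < m) (hg : 0 < g) (t : ℝ) (h1 : x ≤ 2 * g)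
    (h2 : x ≤ g * decay m μ t) : x ≤ errorBound m g μ t / 3 := by
  have hy := decay_pos (μ := μ) hm t
  set y := decay m μ t
  have : errorBound m g μ t / 3 = 4 * g * y / (1 + y) := by rw [errorBound]; ring
  rw [this, le_div_iff₀ (by positivity)]
  -- A third of the bound is 4gy/(1 + y), which dominates gy when y ≤ 1 and 2g when y ≥ 1. The
  -- factor 12 = 3 · 4 reserves the other two thirds for the damping of the right error.
  rcases le_total y 1 with h | h
  · nlinarith [mul_pos hg hy]
  · nlinarith [mul_pos hg hy]

/-- Serves to absorb Δ, which is of order g² e^{-2μt}, into g times the error bound. -/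
theorem exp_le_errorBound (hm : 2 ≤ m) (hg : 0 < g) {t : ℝ} (ht : 0 ≤ μ * t) :
    2 * g * Real.exp (-(μ * t)) ^ 2 ≤ errorBound m g μ t / 3 := by
  have hs := two_le_sqrt hm
  set a := √(2 * (m : ℝ)) with ha
  set z := Real.exp (-(μ * t)) with hz
  have hz0 : 0 < z := Real.exp_pos _
  have hz1 : z ≤ 1 := Real.exp_le_one_iff.2 (by linarith)
  have : errorBound m g μ t / 3 = 4 * g * (a * z) / (1 + a * z) := by
    rw [errorBound, decay, ← ha, ← hz]; ring
  rw [this, le_div_iff₀ (by positivity)]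
  have h1 : z * (1 + a * z) ≤ 2 * a := by
    calc z * (1 + a * z) ≤ 1 * (1 + a * 1) := by gcongr
      _ ≤ 2 * a := by linarith
  nlinarith [mul_le_mul_of_nonneg_left h1 (mul_pos hg hz0).le]

/-- The integral is at most (12g/μ) log(1 + √(2m)), the contribution of the initial time, and 1 +
√(2m) ≤ m². -/
theorem errorBoundInt_sub_le (hm : 2 ≤ m) (hg : 0 < g) (hμ : 0 < μ) (t : ℝ) :
    errorBoundInt m g μ t - errorBoundInt m g μ 0 ≤ 24 * g / μ * Real.log m := by
  have hm0 : 0 < m := by omega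
  have hm' : (2 : ℝ) ≤ m := by exact_mod_cast hm
  have hy := decay_pos (μ := μ) hm0 t
  have h1 : 0 ≤ Real.log (1 + decay m μ t) := Real.log_nonneg (by linarith)
  have h2 : Real.log (1 + decay m μ 0) ≤ 2 * Real.log m := by
    have : decay m μ 0 = √(2 * m) := by simp [decay]
    rw [this]
    have h3 : 1 + √(2 * m) ≤ (m : ℝ) ^ 2 := by
      have : √(2 * (m : ℝ)) ≤ m := Real.sqrt_le_iff.2 ⟨by linarith, by nlinarith⟩
      nlinarith
    calc _ ≤ Real.log ((m : ℝ) ^ 2) := Real.log_le_log (by positivity) h3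
      _ = _ := by rw [Real.log_pow]; norm_num
  have h4 : 0 < 12 * g / μ := by positivity
  unfold errorBoundInt
  have : 24 * g / μ * Real.log m = 12 * g / μ * (2 * Real.log m) := by ring
  rw [this]
  nlinarith [mul_le_mul_of_nonneg_left h2 h4.le, mul_nonneg h4.le h1]

end ErrorBound

/-! ### The bootstrap: decay of Δ preserves the gap, and the gap forces decay. -/

/-- The quantitative hypotheses on the initial operator used for the analysis of the flow. -/
structure IsGapped (ε lam : ℝ) (A : Fin k → Matrix (Fin m) (Fin n) ℝ) : Prop where
  two_le : 2 ≤ m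
  le : m ≤ n
  size_pos : 0 < size A
  lam_pos : 0 < lam
  lam_le : lam ≤ 1
  eps_pos : 0 < ε
  eps_log : 4096 * ε * Real.log m ≤ lam ^ 2
  symL : SymBound (ε * size A) (errL A)
  symR : SymBound (ε * size A) (errR A)
  gap : ∀ (U : Matrix (Fin m) (Fin m) ℝ) (V : Matrix (Fin n) (Fin n) ℝ), trace V = 0 →
    (m * n : ℝ) * bil A U V ^ 2 ≤ ((1 - lam) ^ 2 + 3 * ε) * size A ^ 2 * (fsq U * fsq V)

namespace IsGapped

variable {ε lam : ℝ} {X : ℝ → Fin k → Matrix (Fin m) (Fin n) ℝ} (hA : IsGapped ε lam (X 0))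

include hA

theorem m_pos : 0 < m := by have := hA.two_le; omega

theorem n_pos : 0 < n := by have := hA.two_le; have := hA.le; omega

theorem eps_le : ε ≤ lam ^ 2 / 2800 := by
  -- The constant 2800 is just below 4096 log 2.
  have h1 : Real.log 2 ≤ Real.log m :=
    Real.log_le_log (by norm_num) (by exact_mod_cast hA.two_le)
  have h2 := Real.log_two_gt_d9
  have h3 := hA.eps_log
  have h4 := hA.eps_pos
  nlinarith [mul_le_mul_of_nonneg_left (h2.le.trans h1) h4.le]

theorem eps_le' : ε ≤ lam / 2800 := by
  have := hA.eps_le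
  have := hA.lam_le
  have := hA.lam_pos
  nlinarith

theorem delta_zero_le : delta (X 0) ≤ 2 * (ε * size (X 0)) ^ 2 :=
  delta_le_of_symBound hA.m_pos hA.n_pos (mul_pos hA.eps_pos hA.size_pos) hA.symL hA.symR

variable (h : IsFlow X) {T : ℝ}
  (hΔ : ∀ t ∈ Icc 0 T, delta (X t) ≤ delta (X 0) * Real.exp (-(lam * size (X 0) * t)))

include h hΔ

/-- Integrating s' = -2Δ against the assumed decay loses at most 2Δ(0)/(λ s₀) ≤ 4ε² s₀/λ, and ε is
much smaller than λ. -/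
theorem size_sub_le {t : ℝ} (ht : t ∈ Icc 0 T) : size (X 0) - size (X t) ≤ ε * size (X 0) := by
  have hs := hA.size_pos
  have hl := hA.lam_pos
  have he := hA.eps_pos
  have hm := hA.m_pos.ne'
  have hn := hA.n_pos.ne'
  set r := lam * size (X 0) with hr
  have hrpos : 0 < r := mul_pos hl hs
  have hd : ∀ τ, HasDerivAt (fun τ => delta (X 0) / r * 2 * (1 - Real.exp (-(r * τ))) - size (X 0))
      (2 * (delta (X 0) * Real.exp (-(r * τ)))) τ := by
    intro τ
    have h1 : HasDerivAt (fun t => -(r * t)) (-(r * 1)) τ := ((hasDerivAt_id τ).const_mul r).neg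
    refine (((h1.exp.const_sub 1).const_mul (delta (X 0) / r * 2)).sub_const _).congr_deriv ?_
    field_simp
  have := image_le_of_deriv_right_le_deriv_boundary
      (f := fun τ => -size (X τ)) (a := 0) (b := t)
      (B := fun τ => delta (X 0) / r * 2 * (1 - Real.exp (-(r * τ))) - size (X 0))
      (fun τ hτ => (h.size hm hn hτ.1).continuousWithinAt.neg.mono Icc_subset_Ici_self)
      (fun τ hτ => ((h.size hm hn hτ.1).mono (Ici_subset_Ici.2 hτ.1)).neg) (by simp)
      (fun τ _ => (hd τ).continuousAt.continuousWithinAt) (fun τ _ => (hd τ).hasDerivWithinAt)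
      (fun τ hτ => by
        have := hΔ τ ⟨hτ.1, hτ.2.le.trans ht.2⟩
        linarith) (right_mem_Icc.2 ht.1)
  have h3 : delta (X 0) / r ≤ 2 * ε ^ 2 * size (X 0) / lam := by
    rw [div_le_div_iff₀ hrpos hl, hr]
    have := mul_le_mul_of_nonneg_right hA.delta_zero_le hl.le
    linarith
  have h4 : 2 * ε ^ 2 * size (X 0) / lam * 2 ≤ ε * size (X 0) := by
    rw [div_mul_eq_mul_div, div_le_iff₀ hl]
    have := hA.eps_le'
    nlinarith [mul_pos he hs]
  have h5 := delta_nonneg (X 0)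
  have h6 : delta (X 0) / r * 2 * (1 - Real.exp (-(r * t))) ≤ delta (X 0) / r * 2 * 1 := by
    have := Real.exp_pos (-(r * t))
    gcongr
    linarith
  linarith

theorem symBound_two {t : ℝ} (ht : t ∈ Icc 0 T) :
    SymBound (2 * (ε * size (X 0))) (errL (X t)) ∧
      SymBound (2 * (ε * size (X 0))) (errR (X t)) := by
  have h1 := h.symBound hA.m_pos.ne' hA.n_pos.ne' hA.symL hA.symR ht.1
  have h2 := hA.size_sub_le h hΔ ht
  exact ⟨h1.1.mono (by linarith), h1.2.mono (by linarith)⟩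

omit h in
theorem delta_le_exp {t : ℝ} (ht : t ∈ Icc 0 T) : delta (X t) ≤
    2 * (ε * size (X 0)) ^ 2 * Real.exp (-(lam * size (X 0) / 2 * t)) ^ 2 := by
  rw [← Real.exp_nat_mul]
  have : ((2 : ℕ) : ℝ) * -(lam * size (X 0) / 2 * t) = -(lam * size (X 0) * t) := by
    push_cast; ring
  rw [this]
  refine (hΔ t ht).trans ?_
  have := hA.delta_zero_le
  gcongr

/-- Two estimates are merged: the uniform bound 2ε s₀, good at early times, and the Frobenius bound
√(mΔ), good at late times. -/
theorem symBound_errL {t : ℝ} (ht : t ∈ Icc 0 T) :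
    SymBound (errorBound m (ε * size (X 0)) (lam * size (X 0) / 2) t / 3) (errL (X t)) := by
  have hg := mul_pos hA.eps_pos hA.size_pos
  have hm := hA.m_pos
  set g := ε * size (X 0) with hgd
  set y := decay m (lam * size (X 0) / 2) t with hy
  have hyp : 0 < y := decay_pos hm t
  have h1 := (hA.symBound_two h hΔ ht).1
  have h2 : SymBound (g * y) (errL (X t)) := by
    refine symBound_of_fsq_le (by positivity) ((fsq_errL_le hm).trans ?_)
    have := hA.delta_le_exp hΔ ht
    have hy2 : y ^ 2 = 2 * m * Real.exp (-(lam * size (X 0) / 2 * t)) ^ 2 := by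
      rw [hy, decay, mul_pow, Real.sq_sqrt (by positivity)]
    rw [← hgd] at this
    rw [mul_pow, hy2]
    calc _ ≤ (m : ℝ) * (2 * g ^ 2 * Real.exp (-(lam * size (X 0) / 2 * t)) ^ 2) := by gcongr
      _ = _ := by ring
  have h3 : SymBound (min (2 * g) (g * y)) (errL (X t)) := by
    rcases min_choice (2 * g) (g * y) with h | h <;> rw [h] <;> assumption
  exact h3.mono (le_errorBound hm hg t (min_le_left _ _) (min_le_right _ _))

/-- With H the error bound and the left error below H/3, the net damping is (4/3)(s - H)H ≥ (6/5) s₀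
H. This beats both the decrease of H, at most (λ s₀/2)H, and the tiny term 2Δ. No dimension factor
√n enters. -/
theorem symBound_errR : ∀ t ∈ Icc 0 T,
    SymBound (errorBound m (ε * size (X 0)) (lam * size (X 0) / 2) t) (errR (X t)) := by
  have hs := hA.size_pos
  have hg := mul_pos hA.eps_pos hs
  have hm := hA.m_pos
  have hl := hA.lam_pos
  have hμ : 0 < lam * size (X 0) / 2 := by positivity
  refine h.symBound_errR hm.ne' hA.n_pos.ne' (fun t ht => hA.symBound_errL h hΔ ht)
    (fun t _ => (hasDerivAt_errorBound hm t).hasDerivWithinAt) hA.symR ?_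
    (fun t _ => (errorBound_pos hm hg t).le) ?_ ?_
  · have h1 := le_errorBound (μ := lam * size (X 0) / 2) (x := ε * size (X 0)) hm hg 0 (by linarith) (by
      rw [decay, mul_zero, neg_zero, Real.exp_zero, mul_one]
      nlinarith [two_le_sqrt hA.two_le])
    linarith
  · intro t _
    have := errorBound_pos (μ := lam * size (X 0) / 2) hm hg t
    linarith
  · intro t ht
    refine lt_of_lt_of_le ?_ (neg_le_deriv_errorBound hm hg hμ t)
    have h1 := errorBound_pos (μ := lam * size (X 0) / 2) hm hg t
    have h2 := errorBound_lt (μ := lam * size (X 0) / 2) hm hg t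
    have h3 := hA.delta_le_exp hΔ ht
    have h4 := exp_le_errorBound (μ := lam * size (X 0) / 2) hA.two_le hg
      (mul_nonneg hμ.le ht.1)
    have h5 := hA.size_sub_le h hΔ ht
    set H := errorBound m (ε * size (X 0)) (lam * size (X 0) / 2) t
    set s₀ := size (X 0)
    have he := hA.eps_le'
    have hl1 := hA.lam_le
    have hes : ε * s₀ ≤ s₀ / 2800 := by nlinarith
    have h6 : delta (X t) ≤ (ε * s₀) * (H / 3) := by
      refine h3.trans ?_
      have := mul_le_mul_of_nonneg_left h4 hg.le
      linarith
    have h7 : delta (X t) ≤ s₀ / 2800 * (H / 3) :=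
      h6.trans (mul_le_mul_of_nonneg_right hes (by linarith))
    have h8 : s₀ * 9 / 10 ≤ size (X t) - H := by linarith
    have h9 : s₀ * 9 / 10 * H ≤ (size (X t) - H) * H := mul_le_mul_of_nonneg_right h8 h1.le
    have h10 : lam * s₀ / 2 * H ≤ s₀ / 2 * H := by
      have : lam * s₀ ≤ 1 * s₀ := mul_le_mul_of_nonneg_right hl1 hs.le
      have := mul_le_mul_of_nonneg_right this h1.le
      linarith
    have h11 : 0 < s₀ * H := mul_pos hs h1
    linarith

theorem symBound_errorBound {t : ℝ} (ht : t ∈ Icc 0 T) :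
    SymBound (errorBound m (ε * size (X 0)) (lam * size (X 0) / 2) t) (errL (X t)) ∧
      SymBound (errorBound m (ε * size (X 0)) (lam * size (X 0) / 2) t) (errR (X t)) := by
  have := errorBound_pos (μ := lam * size (X 0) / 2) hA.m_pos (mul_pos hA.eps_pos hA.size_pos) t
  exact ⟨(hA.symBound_errL h hΔ ht).mono (by linarith), hA.symBound_errR h hΔ t ht⟩

omit h hΔ in
-- With g = ε s₀ and μ = λ s₀/2 the integral is at most 48 ε log m / λ. This is where λ² ≥ 4096 ε
-- log m turns accumulated error into a small fraction of λ.
theorem errorBoundInt_sub_le_lam (t : ℝ) :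
    errorBoundInt m (ε * size (X 0)) (lam * size (X 0) / 2) t -
      errorBoundInt m (ε * size (X 0)) (lam * size (X 0) / 2) 0 ≤ 48 * lam / 4096 := by
  have hs := hA.size_pos
  have hl := hA.lam_pos
  refine (errorBoundInt_sub_le hA.two_le (mul_pos hA.eps_pos hs) (by positivity) t).trans ?_
  have h1 := hA.eps_log
  have : 24 * (ε * size (X 0)) / (lam * size (X 0) / 2) * Real.log m =
      48 * (ε * Real.log m) / lam := by
    field_simp
    ring
  rw [this, div_le_iff₀ hl]
  linarith

/-- Persistence of the gap: (1 - λ)² + 3ε ≤ (1 - 7λ/8)² initially, and the drift costs at most 8 ·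
48λ/4096 = 3λ/32 ≤ λ/8. -/
theorem bil_le (hT : 0 ≤ T) (U : Matrix (Fin m) (Fin m) ℝ) (V : Matrix (Fin n) (Fin n) ℝ)
    (hV : trace V = 0) : (m * n : ℝ) * bil (X T) U V ^ 2 ≤
      ((1 - 3 / 4 * lam) * size (X 0)) ^ 2 * (fsq U * fsq V) := by
  have hs := hA.size_pos
  have hg := mul_pos hA.eps_pos hs
  have hm := hA.m_pos
  have hm' : (0 : ℝ) < m := by exact_mod_cast hm
  have hn' : (0 : ℝ) < n := by exact_mod_cast hA.n_pos
  have hl := hA.lam_pos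
  have hl1 := hA.lam_le
  have he := hA.eps_le'
  have hμ : 0 < lam * size (X 0) / 2 := by positivity
  have hUV : 0 ≤ fsq U * fsq V := mul_nonneg (fsq_nonneg _) (fsq_nonneg _)
  have h1 := h.abs_bil_sub_le hm hA.n_pos hT (N := 2 * size (X 0))
    (fun t _ => (hasDerivAt_errorBoundInt (g := ε * size (X 0)) hm hμ.ne' t).hasDerivWithinAt)
    (fun t _ => errorBound_pos hm hg t)
    (fun t ht => by
      have h2 := errorBound_lt (μ := lam * size (X 0) / 2) hm hg t
      have h3 := h.antitoneOn_size hm.ne' hA.n_pos.ne' (mem_Ici.2 le_rfl) ht.1 ht.1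
      have hes : ε * size (X 0) ≤ size (X 0) / 2800 := by nlinarith
      simp only at h3
      linarith)
    (fun t ht => (hA.symBound_errorBound h hΔ ht).1)
    (fun t ht => (hA.symBound_errorBound h hΔ ht).2) U V
  have h2 := hA.errorBoundInt_sub_le_lam T
  have hw : 0 < √(m * n : ℝ) := by positivity
  have hwsq : √(m * n : ℝ) ^ 2 = m * n := Real.sq_sqrt (by positivity)
  set w := √(m * n : ℝ)
  set W := √(fsq U * fsq V)
  have hWsq : W ^ 2 = fsq U * fsq V := Real.sq_sqrt hUV
  have hW : 0 ≤ W := Real.sqrt_nonneg _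
  have h3 : |bil (X 0) U V| ≤ (1 - 7 / 8 * lam) * size (X 0) / w * W := by
    refine abs_le_of_sq_le_sq ?_ (by
      have : 0 ≤ 1 - 7 / 8 * lam := by linarith
      positivity)
    have := hA.gap U V hV
    rw [← hwsq] at this
    rw [mul_pow, div_pow, hWsq, div_mul_eq_mul_div, le_div_iff₀ (by positivity), mul_comm]
    refine this.trans ?_
    rw [mul_pow]
    gcongr
    have := hA.eps_le
    nlinarith
  have h4 : |bil (X T) U V - bil (X 0) U V| ≤ 1 / 8 * lam * size (X 0) / w * W := by
    refine h1.trans ?_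
    have h5 : 0 ≤ 4 * (2 * size (X 0) / w * W) := by positivity
    refine (mul_le_mul_of_nonneg_left h2 h5).trans ?_
    have h6 : 0 ≤ size (X 0) / w * W * lam := by positivity
    have e1 : 4 * (2 * size (X 0) / w * W) * (48 * lam / 4096) =
      3 / 32 * (size (X 0) / w * W * lam) := by ring
    have e2 : 1 / 8 * lam * size (X 0) / w * W = 1 / 8 * (size (X 0) / w * W * lam) := by ring
    rw [e1, e2]
    linarith
  have h5 : |bil (X T) U V| ≤ (1 - 3 / 4 * lam) * size (X 0) / w * W := by
    have e : (1 - 3 / 4 * lam) * size (X 0) / w * W = (1 - 7 / 8 * lam) * size (X 0) / w * W +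
      1 / 8 * lam * size (X 0) / w * W := by ring
    rw [e]
    have := abs_add_le (bil (X 0) U V) (bil (X T) U V - bil (X 0) U V)
    rw [add_sub_cancel] at this
    linarith
  have h6 := sq_le_sq' (abs_le.1 h5).1 (abs_le.1 h5).2
  rw [← hwsq, ← hWsq, mul_comm]
  have e : ((1 - 3 / 4 * lam) * size (X 0) / w * W) ^ 2 =
    ((1 - 3 / 4 * lam) * size (X 0)) ^ 2 * W ^ 2 / w ^ 2 := by ring
  rw [e, le_div_iff₀ (by positivity)] at h6
  exact h6

/-- Of the surviving 3λ/4, at most 3ε ≤ λ/4 is spent on the size loss and the error norms. As Δ' is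
-4 times the right side, Δ decays at rate 2λ s₀, twice what was assumed. -/
theorem le_sum_fsq (hT : 0 ≤ T) :
    lam / 2 * size (X 0) * delta (X T) ≤ ∑ i, fsq (field (X T) i) := by
  have hTT : T ∈ Icc 0 T := right_mem_Icc.2 hT
  have hs := hA.size_pos
  have hl := hA.lam_pos
  have hl1 := hA.lam_le
  have he := hA.eps_le'
  obtain ⟨h1, h2⟩ := hA.symBound_two h hΔ hTT
  have h3 := le_sum_fsq_field (X T) hA.m_pos hA.n_pos h1 h2
    (r := (1 - 3 / 4 * lam) * size (X 0)) (mul_nonneg (by linarith) hs.le)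
    (hA.bil_le h hΔ hT _ _ (trace_errR _))
  refine le_trans (mul_le_mul_of_nonneg_right ?_ (delta_nonneg _)) h3
  have h4 := hA.size_sub_le h hΔ hTT
  have h5 : ε * size (X 0) ≤ lam / 2800 * size (X 0) := mul_le_mul_of_nonneg_right he hs.le
  have h6 : 0 < lam * size (X 0) := mul_pos hl hs
  linarith

omit hΔ in
/-- Linear convergence of the gradient flow. -/
theorem delta_le {t : ℝ} (ht : 0 ≤ t) :
    delta (X t) ≤ delta (X 0) * Real.exp (-(lam * size (X 0) * t)) := by
  have hs := hA.size_pos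
  have hl := hA.lam_pos
  have hm := hA.m_pos.ne'
  have hn := hA.n_pos.ne'
  have hr : 0 < lam * size (X 0) := mul_pos hl hs
  -- A zero initial error is split off, since strictness below needs a positive barrier B.
  rcases (delta_nonneg (X 0)).eq_or_lt with h0 | h0
  · have := h.antitoneOn_delta hm hn (mem_Ici.2 le_rfl) ht ht
    rw [← h0, zero_mul]
    exact this.trans h0.ge
  set r := lam * size (X 0) with hrd
  set B : ℝ → ℝ := fun τ => delta (X 0) * Real.exp (-(r * τ)) with hB
  have hBd : ∀ τ, HasDerivAt B (-r * B τ) τ := by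
    intro τ
    have h1 : HasDerivAt (fun t => -(r * t)) (-(r * 1)) τ := ((hasDerivAt_id τ).const_mul r).neg
    refine (h1.exp.const_mul (delta (X 0))).congr_deriv ?_
    simp only [hB]; ring
  have hBpos : ∀ τ, 0 < B τ := fun τ => mul_pos h0 (Real.exp_pos _)
  have hdc : ContinuousOn (fun τ => delta (X τ)) (Ici 0) := fun τ hτ =>
    (h.delta hm hn hτ).continuousWithinAt
  have hBc : Continuous B := continuous_iff_continuousAt.2 fun τ => (hBd τ).continuousAt
  -- Continuous induction on the set of times up to which the decay has held throughout: it is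
  -- closed by continuity.
  have hgood : Icc 0 t ⊆ {τ | ∀ u ∈ Icc 0 τ, delta (X u) ≤ B u} := by
    refine IsClosed.Icc_subset_of_forall_exists_gt ?_ ?_ ?_
    · have hZ : IsClosed {u ∈ Icc 0 t | delta (X u) ≤ B u} :=
        isClosed_Icc.isClosed_le (hdc.mono Icc_subset_Ici_self) hBc.continuousOn
      refine isClosed_of_closure_subset fun τ hτ => ?_
      have hτZ : τ ∈ {u ∈ Icc 0 t | delta (X u) ≤ B u} := by
        refine closure_minimal ?_ hZ hτ
        rintro σ ⟨hσ1, hσ2⟩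
        exact ⟨hσ2, hσ1 σ ⟨hσ2.1, le_rfl⟩⟩
      refine ⟨fun u hu => ?_, hτZ.1⟩
      rcases hu.2.lt_or_eq with hlt | rfl
      · obtain ⟨σ, hσ1, hσ2, -⟩ := mem_closure_iff.1 hτ (Ioi u) isOpen_Ioi hlt
        exact hσ2 u ⟨hu.1, le_of_lt hσ1⟩
      · exact hτZ.2
    · rintro u ⟨hu0, hu1⟩
      obtain rfl : u = 0 := le_antisymm hu1 hu0
      simp [hB]
    · rintro τ ⟨hτ, hτ0, hτt⟩ y hy
      have hlt : ∀ᶠ u in nhdsWithin τ (Ioi τ), delta (X u) < B u := by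
        have hsub : Ioi τ ⊆ Ici 0 := fun u hu => hτ0.trans (le_of_lt hu)
        rcases (hτ τ ⟨hτ0, le_rfl⟩).lt_or_eq with hlt | heq
        · exact (((hdc τ hτ0).mono hsub).tendsto.eventually_lt
            (hBc.continuousAt.continuousWithinAt (s := Ioi τ)).tendsto hlt)
        -- If Δ touches B, its derivative is at most -2rB < -rB, so Δ lies strictly below B just
        -- afterwards.
        · have hd := ((h.delta hm hn hτ0).mono hsub).sub (hBd τ).hasDerivWithinAt
          have h1 := hA.le_sum_fsq h hτ hτ0
          have h2 := hBpos τ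
          have h3 := mul_pos hr h2
          rw [heq] at h1
          have hneg : -4 * ∑ i, fsq (field (X τ) i) - -r * B τ < 0 := by
            rw [hrd] at h3 ⊢; linarith
          rw [hasDerivWithinAt_iff_tendsto_slope' (by simp)] at hd
          filter_upwards [hd.eventually_lt_const hneg, self_mem_nhdsWithin] with u hu hu1
          have hu2 : τ < u := hu1
          rw [slope_def_field, div_lt_iff₀ (by linarith), zero_mul] at hu
          simp only [Pi.sub_apply, heq] at hu
          linarith
      obtain ⟨u, hu, hall⟩ := (mem_nhdsGT_iff_exists_mem_Ioc_Ioo_subset (hy : τ < y)).1 hlt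
      refine ⟨(τ + u) / 2, ?_, by linarith [hu.1], by linarith [hu.1, hu.2]⟩
      intro v hv
      rcases le_or_gt v τ with h1 | h1
      · exact hτ v ⟨hv.1, h1⟩
      · exact (hall ⟨h1, by linarith [hv.2, hu.1]⟩ : delta (X v) < B v).le
  exact hgood (right_mem_Icc.2 ht) t (right_mem_Icc.2 ht)

end IsGapped

end OperatorScaling

namespace OperatorScaling

open Matrix Set

/-! ### Singular values and Ky Fan's inequality. -/

section SingularValues

open LinearMap Module

variable {E F : Type*} [NormedAddCommGroup E] [InnerProductSpace ℝ E] [FiniteDimensional ℝ E]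
  [NormedAddCommGroup F] [InnerProductSpace ℝ F] [FiniteDimensional ℝ F] (T : E →ₗ[ℝ] F)

theorem norm_map_sq_eq_sum {N : ℕ} (hN : finrank ℝ E = N) (x : E) :
    ‖T x‖ ^ 2 = ∑ i : Fin N, T.singularValues i ^ 2 *
      inner ℝ (T.isSymmetric_adjoint_comp_self.eigenvectorBasis hN i) x ^ 2 := by
  have h1 : ‖T x‖ ^ 2 = inner ℝ x ((adjoint T ∘ₗ T) x) := by
    rw [LinearMap.comp_apply, adjoint_inner_right, real_inner_self_eq_norm_sq]
  rw [h1, ← (T.isSymmetric_adjoint_comp_self.eigenvectorBasis hN).sum_inner_mul_inner]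
  refine Finset.sum_congr rfl fun i _ => ?_
  rw [← T.isSymmetric_adjoint_comp_self _ x,
    T.isSymmetric_adjoint_comp_self.apply_eigenvectorBasis hN, inner_smul_left,
    T.sq_singularValues_fin hN, real_inner_comm]
  simp
  ring

theorem sq_singularValues_zero_le {c : ℝ} (hE : 0 < finrank ℝ E)
    (hc : ∀ x, ‖T x‖ ^ 2 ≤ c * ‖x‖ ^ 2) : T.singularValues 0 ^ 2 ≤ c := by
  set b := T.isSymmetric_adjoint_comp_self.eigenvectorBasis rfl with hb
  have h1 := norm_map_sq_eq_sum T rfl (b ⟨0, hE⟩)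
  have h2 := hc (b ⟨0, hE⟩)
  rw [h1, b.norm_eq_one] at h2
  simp only [← hb, b.inner_eq_ite] at h2
  simpa using h2

/-- Ky Fan's inequality for the two largest singular values. -/
theorem norm_sq_add_norm_sq_le (hE : 2 ≤ finrank ℝ E) {u y : E} (hu : ‖u‖ = 1) (hy : ‖y‖ = 1)
    (huy : inner ℝ u y = 0) :
    ‖T u‖ ^ 2 + ‖T y‖ ^ 2 ≤ T.singularValues 0 ^ 2 + T.singularValues 1 ^ 2 := by
  set b := T.isSymmetric_adjoint_comp_self.eigenvectorBasis rfl with hb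
  rw [norm_map_sq_eq_sum T rfl u, norm_map_sq_eq_sum T rfl y, ← hb, ← Finset.sum_add_distrib]
  simp only [← mul_add]
  set P : Fin (finrank ℝ E) → ℝ := fun i => inner ℝ (b i) u ^ 2 + inner ℝ (b i) y ^ 2 with hP
  have hsum : ∑ i, P i = 2 := by
    have h1 := b.sum_sq_norm_inner_right u
    have h2 := b.sum_sq_norm_inner_right y
    simp only [Real.norm_eq_abs, sq_abs, hu, hy] at h1 h2
    simp only [hP, Finset.sum_add_distrib]
    rw [h1, h2]; norm_num
  have hP0 : ∀ i, 0 ≤ P i := fun i => add_nonneg (sq_nonneg _) (sq_nonneg _)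
  -- Bessel's inequality for b i against the orthonormal pair u, y.
  have hP1 : ∀ i, P i ≤ 1 := by
    intro i
    have h0 : 0 ≤ ‖b i - (inner ℝ (b i) u • u + inner ℝ (b i) y • y)‖ ^ 2 := sq_nonneg _
    have h3 : ‖inner ℝ (b i) u • u + inner ℝ (b i) y • y‖ ^ 2 = P i := by
      rw [norm_add_sq_real, norm_smul, norm_smul, inner_smul_left, inner_smul_right, huy, hu, hy]
      simp [hP]
    rw [norm_sub_sq_real, h3, b.norm_eq_one, inner_add_right, inner_smul_right,
      inner_smul_right] at h0
    have : P i = inner ℝ (b i) u * inner ℝ (b i) u + inner ℝ (b i) y * inner ℝ (b i) y := by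
      simp only [hP]; ring
    linarith
  have hi0 : 0 < finrank ℝ E := by omega
  -- The weights P have total 2 and are at most 1 each. Charging every index at the second singular
  -- value leaves an excess at index 0 only, where the weight is at most 1.
  have hle : ∀ i : Fin (finrank ℝ E), T.singularValues i ^ 2 * P i ≤
      T.singularValues 1 ^ 2 * P i + (if i = ⟨0, hi0⟩ then
        (T.singularValues 0 ^ 2 - T.singularValues 1 ^ 2) * P ⟨0, hi0⟩ else 0) := by
    intro i
    split_ifs with hi
    · subst hi; simp only; linarith
    · have h1 : 1 ≤ (i : ℕ) := by
        have : (i : ℕ) ≠ 0 := fun h => hi (Fin.ext h)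
        omega
      have h2 := T.singularValues_antitone h1
      have h3 := T.singularValues_nonneg i
      have := hP0 i
      rw [add_zero]
      gcongr
  refine (Finset.sum_le_sum fun i _ => hle i).trans ?_
  rw [Finset.sum_add_distrib, ← Finset.mul_sum, hsum]
  simp only [Finset.sum_ite_eq', Finset.mem_univ, if_true]
  have h2 := T.singularValues_antitone (zero_le_one (α := ℕ))
  have h3 := T.singularValues_nonneg 1
  have h4 : T.singularValues 1 ^ 2 ≤ T.singularValues 0 ^ 2 := by gcongr
  nlinarith [hP1 ⟨0, hi0⟩]

end SingularValues

/-! ### Vectorisation, and translation of the balance and gap hypotheses. -/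

/-- A matrix as a vector in Euclidean space. -/
noncomputable def toVec {p q : Type*} (M : Matrix p q ℝ) : EuclideanSpace ℝ (p × q) :=
  WithLp.toLp 2 fun z => M z.1 z.2

section toVec

variable {p q : Type*} [Fintype p] [Fintype q]

theorem inner_toVec (M N : Matrix p q ℝ) :
    inner ℝ (toVec M) (toVec N) = ∑ a, ∑ b, M a b * N a b := by
  simp [toVec, PiLp.inner_apply, Fintype.sum_prod_type, mul_comm]

theorem norm_toVec_sq (M : Matrix p q ℝ) : ‖toVec M‖ ^ 2 = fsq M := by
  rw [← real_inner_self_eq_norm_sq, inner_toVec]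
  simp [fsq, sq]

omit [Fintype p] [Fintype q] in
theorem exists_toVec_eq (x : EuclideanSpace ℝ (p × q)) : ∃ M : Matrix p q ℝ, toVec M = x :=
  ⟨fun a b => x (a, b), rfl⟩

end toVec

variable {m n k : ℕ} (A : Fin k → Matrix (Fin m) (Fin n) ℝ)

/-- The vectorisation identity (A ⊗ A) vec V = vec(A V Aᵀ). -/
theorem inner_toVec_matrixRep (U : Matrix (Fin m) (Fin m) ℝ) (V : Matrix (Fin n) (Fin n) ℝ) :
    inner ℝ (toVec U) (Matrix.toEuclideanLin (matrixRep A) (toVec V)) = bil A U V := by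
  have h : Matrix.toEuclideanLin (matrixRep A) (toVec V) =
      toVec (∑ i, A i * V * (A i)ᵀ) := by
    ext ⟨a, a'⟩
    change (matrixRep A *ᵥ fun z => V z.1 z.2) (a, a') = (∑ i, A i * V * (A i)ᵀ) a a'
    simp only [matrixRep, Matrix.sum_apply, mulVec, dotProduct, kroneckerMap_apply, Fintype.sum_prod_type,
      Matrix.mul_apply, transpose_apply, Finset.sum_mul]
    rw [Finset.sum_comm, Finset.sum_comm (s := (Finset.univ : Finset (Fin k)))]
    refine Finset.sum_congr rfl fun b' _ => ?_
    rw [Finset.sum_comm (s := (Finset.univ : Finset (Fin k)))]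
    exact Finset.sum_congr rfl fun b _ => Finset.sum_congr rfl fun i _ => by ring
  rw [h, inner_toVec, bil]
  have h2 : ∀ i, trace (Uᵀ * A i * V * (A i)ᵀ) = ∑ a, ∑ b, U a b * (A i * V * (A i)ᵀ) a b := by
    intro i
    rw [Matrix.mul_assoc, Matrix.mul_assoc, trace, Finset.sum_comm]
    simp only [diag, Matrix.mul_apply (M := Uᵀ), transpose_apply, Matrix.mul_assoc]
  simp only [h2, Matrix.sum_apply, Finset.mul_sum]
  symm
  rw [Finset.sum_comm]
  exact Finset.sum_congr rfl fun a _ => Finset.sum_comm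

theorem symBound_errL_of_nearlyDoublyBalanced {ε : ℝ} (hm : 0 < m)
    (h : NearlyDoublyBalanced ε A) : SymBound (ε * size A) (errL A) := by
  have hm' : (0 : ℝ) < m := by exact_mod_cast hm
  intro v
  have h1 := h.1.dotProduct_mulVec_nonneg v
  have h2 := h.2.1.dotProduct_mulVec_nonneg v
  simp only [star_trivial, sub_mulVec, smul_mulVec, one_mulVec, dotProduct_sub, dotProduct_smul,
    smul_eq_mul] at h1 h2
  have h3 := mul_nonneg hm'.le h1
  have h4 := mul_nonneg hm'.le h2
  have e1 : (m : ℝ) * ((1 - ε) * (size A / m)) = (1 - ε) * size A := by field_simp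
  have e2 : (m : ℝ) * ((1 + ε) * (size A / m)) = (1 + ε) * size A := by field_simp
  rw [mul_sub, ← mul_assoc (m : ℝ), e1] at h3
  rw [mul_sub, ← mul_assoc (m : ℝ), e2] at h4
  rw [dotProduct_errL, abs_le]
  constructor <;> linarith

theorem nearlyDoublyBalanced_transposeOp {ε : ℝ} (h : NearlyDoublyBalanced ε A) :
    NearlyDoublyBalanced ε (transposeOp A) := by
  obtain ⟨h1, h2, h3, h4⟩ := h
  refine ⟨?_, ?_, ?_, ?_⟩ <;>
    simpa only [leftMarginal_transposeOp, rightMarginal_transposeOp, size_transposeOp]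

theorem symBound_errR_of_nearlyDoublyBalanced {ε : ℝ} (hn : 0 < n)
    (h : NearlyDoublyBalanced ε A) : SymBound (ε * size A) (errR A) := by
  have := symBound_errL_of_nearlyDoublyBalanced _ hn (nearlyDoublyBalanced_transposeOp A h)
  rwa [errL_transposeOp, size_transposeOp] at this

theorem posSemidef_of_symBound {ε : ℝ} (hm : 0 < m) (h : SymBound (ε * size A) (errL A)) :
    (leftMarginal A - ((1 - ε) * (size A / m)) • (1 : Matrix (Fin m) (Fin m) ℝ)).PosSemidef ∧
    (((1 + ε) * (size A / m)) • (1 : Matrix (Fin m) (Fin m) ℝ) - leftMarginal A).PosSemidef := by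
  have hm' : (0 : ℝ) < m := by exact_mod_cast hm
  have hs := isSymm_leftMarginal A
  constructor <;> refine PosSemidef.of_dotProduct_mulVec_nonneg ?_ fun v => ?_
  · rw [IsHermitian, conjTranspose_eq_transpose_of_trivial]; simp [hs.eq]
  · have h1 := (abs_le.1 (h v)).2
    rw [dotProduct_errL] at h1
    simp only [star_trivial, sub_mulVec, smul_mulVec, one_mulVec, dotProduct_sub, dotProduct_smul,
      smul_eq_mul]
    rw [sub_nonneg, ← mul_le_mul_iff_right₀ hm', ← mul_assoc]
    have e1 : (m : ℝ) * ((1 - ε) * (size A / m)) = (1 - ε) * size A := by field_simp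
    rw [e1]; linarith
  · rw [IsHermitian, conjTranspose_eq_transpose_of_trivial]; simp [hs.eq]
  · have h1 := (abs_le.1 (h v)).1
    rw [dotProduct_errL] at h1
    simp only [star_trivial, sub_mulVec, smul_mulVec, one_mulVec, dotProduct_sub, dotProduct_smul,
      smul_eq_mul]
    rw [sub_nonneg, ← mul_le_mul_iff_right₀ hm', ← mul_assoc (m : ℝ) _ (v ⬝ᵥ v)]
    have e1 : (m : ℝ) * ((1 + ε) * (size A / m)) = (1 + ε) * size A := by field_simp
    rw [e1]; linarith

theorem nearlyDoublyBalanced_of_symBound {ε : ℝ} (hm : 0 < m) (hn : 0 < n)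
    (hL : SymBound (ε * size A) (errL A)) (hR : SymBound (ε * size A) (errR A)) :
    NearlyDoublyBalanced ε A := by
  have h1 := posSemidef_of_symBound A hm hL
  have h2 := posSemidef_of_symBound (transposeOp A) hn
    (by rwa [errL_transposeOp, size_transposeOp])
  rw [leftMarginal_transposeOp, size_transposeOp] at h2
  exact ⟨h1.1, h1.2, h2.1, h2.2⟩

theorem lam_le_one_of_hasSpectralGap {lam : ℝ} (hm : 0 < m) (hn : 0 < n) (hs : 0 < size A)
    (h : HasSpectralGap lam A) : lam ≤ 1 := by
  have hm' : (0 : ℝ) < m := by exact_mod_cast hm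
  have hn' : (0 : ℝ) < n := by exact_mod_cast hn
  have h1 : 0 ≤ sigmaTwo A := LinearMap.singularValues_nonneg _ _
  have h2 : 0 < size A / √(m * n : ℝ) := by positivity
  have h3 := h1.trans h
  by_contra! hcon
  nlinarith

/-- The spectral gap controls the bilinear form on trace zero matrices. -/
theorem bil_sq_le_of_hasSpectralGap {ε lam : ℝ} (hm : 2 ≤ m) (hn : 2 ≤ n) (hs : 0 < size A)
    (hε : 0 < ε) (hε1 : ε ≤ 1) (hL : SymBound (ε * size A) (errL A))
    (hR : SymBound (ε * size A) (errR A)) (h : HasSpectralGap lam A)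
    (U : Matrix (Fin m) (Fin m) ℝ) (V : Matrix (Fin n) (Fin n) ℝ) (hV : trace V = 0) :
    (m * n : ℝ) * bil A U V ^ 2 ≤ ((1 - lam) ^ 2 + 3 * ε) * size A ^ 2 * (fsq U * fsq V) := by
  have hm' : (0 : ℝ) < m := by exact_mod_cast (by omega : 0 < m)
  have hn' : (0 : ℝ) < n := by exact_mod_cast (by omega : 0 < n)
  have hmn : (0 : ℝ) < m * n := mul_pos hm' hn'
  set T := Matrix.toEuclideanLin (matrixRep A) with hT
  have hcs : ∀ U V, bil A U V ^ 2 ≤ fsq U * ‖T (toVec V)‖ ^ 2 := by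
    intro U V
    rw [← inner_toVec_matrixRep, ← norm_toVec_sq, ← mul_pow]
    exact sq_le_sq' (neg_le_of_abs_le (abs_real_inner_le_norm _ _)) (real_inner_le_norm _ _)
  -- The bilinear bound is tested with the left argument equal to the image of the right one.
  have hop : ∀ x, ‖T x‖ ^ 2 ≤ ((1 + ε) * size A) ^ 2 / (m * n) * ‖x‖ ^ 2 := by
    intro x
    obtain ⟨W, rfl⟩ := exists_toVec_eq x
    obtain ⟨Y, hY⟩ := exists_toVec_eq (T (toVec W))
    have h1 := mul_bil_sq_le A hL hR Y W
    rw [← inner_toVec_matrixRep, ← hT, hY, real_inner_self_eq_norm_sq, ← norm_toVec_sq,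
      ← norm_toVec_sq W, hY] at h1
    rw [div_mul_eq_mul_div, le_div_iff₀ hmn]
    rcases (sq_nonneg ‖T (toVec W)‖).eq_or_lt with h0 | h0
    · rw [← h0]; simp; positivity
    · nlinarith
  have hfr : 2 ≤ Module.finrank ℝ (EuclideanSpace ℝ (Fin n × Fin n)) := by
    simp; nlinarith
  have hσ0 := sq_singularValues_zero_le T (by omega) hop
  have hσ1 : T.singularValues 1 ^ 2 ≤ (1 - lam) ^ 2 * size A ^ 2 / (m * n) := by
    have h1 : T.singularValues 1 ≤ (1 - lam) * (size A / √(m * n : ℝ)) := h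
    have h0 := T.singularValues_nonneg 1
    calc T.singularValues 1 ^ 2 ≤ ((1 - lam) * (size A / √(m * n : ℝ))) ^ 2 := by gcongr
      _ = _ := by rw [mul_pow, div_pow, Real.sq_sqrt hmn.le]; ring
  -- The form at the two identities equals s, so the normalised identity is stretched by at least
  -- s/√(mn), almost the top singular value.
  have h1 : size A ^ 2 ≤ m * ‖T (toVec (1 : Matrix (Fin n) (Fin n) ℝ))‖ ^ 2 := by
    have h2 := hcs 1 1
    have h3 : bil A 1 1 = size A := by
      simp only [bil, transpose_one, Matrix.one_mul, Matrix.mul_one]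
      rw [← trace_leftMarginal, leftMarginal, trace_sum]
    rwa [h3, fsq_one, Fintype.card_fin] at h2
  have key : (m * n) * ‖T (toVec V)‖ ^ 2 ≤ ((1 - lam) ^ 2 + 3 * ε) * size A ^ 2 * fsq V := by
    rcases (fsq_nonneg V).eq_or_lt with h0 | h0
    · have h2 := hop (toVec V)
      rw [norm_toVec_sq, ← h0] at h2
      rw [← h0]
      have h3 : ‖T (toVec V)‖ ^ 2 = 0 := le_antisymm (by simpa using h2) (sq_nonneg _)
      rw [h3]; simp
    have hu : ‖toVec (1 : Matrix (Fin n) (Fin n) ℝ)‖ ^ 2 = n := by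
      rw [norm_toVec_sq, fsq_one, Fintype.card_fin]
    have hv := norm_toVec_sq V
    set x := toVec (1 : Matrix (Fin n) (Fin n) ℝ)
    set y := toVec V
    have hx0 : 0 < ‖x‖ := by
      rcases (norm_nonneg x).eq_or_lt with h | h
      · rw [← h] at hu; norm_num at hu; linarith
      · exact h
    have hy0 : 0 < ‖y‖ := by
      rcases (norm_nonneg y).eq_or_lt with h | h
      · rw [← h] at hv; norm_num at hv; linarith
      · exact h
    have hxy : inner ℝ x y = 0 := by
      rw [inner_toVec, ← hV, trace]
      refine Finset.sum_congr rfl fun a _ => ?_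
      simp [Matrix.one_apply]
    -- The identity already uses up nearly all of σ₁², so Ky Fan leaves about σ₂² for V. The deficit
    -- is (1 + ε)² - 1 = (2 + ε)ε ≤ 3ε in units of s²/(mn).
    have h2 := norm_sq_add_norm_sq_le T hfr (u := ‖x‖⁻¹ • x) (y := ‖y‖⁻¹ • y)
      (by rw [norm_smul, norm_inv, norm_norm, inv_mul_cancel₀ hx0.ne'])
      (by rw [norm_smul, norm_inv, norm_norm, inv_mul_cancel₀ hy0.ne'])
      (by rw [inner_smul_left, inner_smul_right, hxy]; simp)
    rw [map_smul, map_smul, norm_smul, norm_smul, norm_inv, norm_inv, norm_norm, norm_norm,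
      mul_pow, mul_pow, inv_pow, inv_pow, hu, hv] at h2
    have h3 := h2.trans (add_le_add hσ0 hσ1)
    have h4 : size A ^ 2 / (m * n) ≤ (n : ℝ)⁻¹ * ‖T x‖ ^ 2 := by
      rw [div_le_iff₀ hmn]
      calc size A ^ 2 ≤ m * ‖T x‖ ^ 2 := h1
        _ = _ := by field_simp
    have h5 : (fsq V)⁻¹ * ‖T y‖ ^ 2 ≤ ((1 - lam) ^ 2 + 3 * ε) * size A ^ 2 / (m * n) := by
      have e : ((1 + ε) * size A) ^ 2 / (m * n) + (1 - lam) ^ 2 * size A ^ 2 / (m * n) -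
          size A ^ 2 / (m * n) = ((1 - lam) ^ 2 + (2 + ε) * ε) * size A ^ 2 / (m * n) := by
        ring
      have h6 : ((1 - lam) ^ 2 + (2 + ε) * ε) * size A ^ 2 / (m * n) ≤
          ((1 - lam) ^ 2 + 3 * ε) * size A ^ 2 / (m * n) := by
        gcongr
        linarith
      linarith
    rw [inv_mul_le_iff₀ h0, ← mul_div_assoc, le_div_iff₀ hmn] at h5
    linarith
  have hU := fsq_nonneg U
  calc (m * n : ℝ) * bil A U V ^ 2 ≤ (m * n : ℝ) * (fsq U * ‖T (toVec V)‖ ^ 2) := by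
        gcongr
        exact hcs U V
    _ = fsq U * ((m * n) * ‖T (toVec V)‖ ^ 2) := by ring
    _ ≤ fsq U * (((1 - lam) ^ 2 + 3 * ε) * size A ^ 2 * fsq V) := by gcongr
    _ = _ := by ring

/-- The balance parameter is enlarged to the greatest admissible value λ²/(4096 log m), which is
positive even when the given ε is zero. -/
theorem isGapped_of_hasSpectralGap {ε lam : ℝ} (hm : 2 ≤ m) (hmn : m ≤ n) (hA : A ≠ 0)
    (hlam : 0 < lam) (hb : NearlyDoublyBalanced ε A) (hg : HasSpectralGap lam A)
    (hε : 4096 * ε * Real.log m ≤ lam ^ 2) :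
    IsGapped (lam ^ 2 / (4096 * Real.log m)) lam A := by
  have hs := size_pos A hA
  have h1 : Real.log 2 ≤ Real.log m := Real.log_le_log (by norm_num) (by exact_mod_cast hm)
  have h2 := Real.log_two_gt_d9
  have hlog : 0 < Real.log m := by linarith
  have hlam1 := lam_le_one_of_hasSpectralGap A (by omega) (by omega) hs hg
  have hle : ε ≤ lam ^ 2 / (4096 * Real.log m) := by
    rw [le_div_iff₀ (by positivity)]; linarith
  have hL := (symBound_errL_of_nearlyDoublyBalanced A (by omega) hb).mono
    (mul_le_mul_of_nonneg_right hle hs.le)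
  have hR := (symBound_errR_of_nearlyDoublyBalanced A (by omega) hb).mono
    (mul_le_mul_of_nonneg_right hle hs.le)
  refine ⟨hm, hmn, hs, hlam, hlam1, by positivity, ?_, hL, hR, fun U V hV =>
    bil_sq_le_of_hasSpectralGap A hm (by omega) hs (by positivity) ?_ hL hR hg U V hV⟩
  · apply le_of_eq; field_simp
  · rw [div_le_one (by positivity)]; nlinarith

end OperatorScaling

namespace OperatorScaling

open Matrix Set

/-! ### Uniqueness, global existence and Grönwall for autonomous equations. -/

section ODE

variable {E : Type*} [NormedAddCommGroup E] [NormedSpace ℝ E] [FiniteDimensional ℝ E] {V : E → E}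

/-- On a compact interval both curves stay in one ball, where a C¹ field is Lipschitz. -/
theorem eqOn_of_hasDerivWithinAt (hV : ContDiff ℝ 1 V) {x y : ℝ → E} {T : ℝ}
    (hx : ∀ t ∈ Icc 0 T, HasDerivWithinAt x (V (x t)) (Icc 0 T) t)
    (hy : ∀ t ∈ Icc 0 T, HasDerivWithinAt y (V (y t)) (Icc 0 T) t) (h0 : x 0 = y 0) :
    EqOn x y (Icc 0 T) := by
  have hxc : ContinuousOn x (Icc 0 T) := fun t ht => (hx t ht).continuousWithinAt
  have hyc : ContinuousOn y (Icc 0 T) := fun t ht => (hy t ht).continuousWithinAt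
  obtain ⟨r₁, hr₁⟩ := isCompact_Icc.exists_bound_of_continuousOn hxc
  obtain ⟨r₂, hr₂⟩ := isCompact_Icc.exists_bound_of_continuousOn hyc
  have : ProperSpace E := FiniteDimensional.proper ℝ E
  obtain ⟨K, hK⟩ := (hV.contDiffOn (s := Metric.closedBall (0 : E) (max r₁ r₂))).exists_lipschitzOnWith
    one_ne_zero (convex_closedBall _ _) (isCompact_closedBall _ _)
  have hright : ∀ t ∈ Ico 0 T, ∀ {z : ℝ → E} {z' : E}, HasDerivWithinAt z z' (Icc 0 T) t →
      HasDerivWithinAt z z' (Ici t) t := by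
    intro t ht z z' hz
    exact (hz.mono (Icc_subset_Icc_left ht.1)).mono_of_mem_nhdsWithin (Icc_mem_nhdsGE ht.2)
  refine ODE_solution_unique_of_mem_Icc_right (v := fun _ => V)
    (s := fun _ => Metric.closedBall (0 : E) (max r₁ r₂)) (fun t _ => hK) hxc
    (fun t ht => hright t ht (hx t (Ico_subset_Icc_self ht))) ?_ hyc
    (fun t ht => hright t ht (hy t (Ico_subset_Icc_self ht))) ?_ h0
  · intro t ht
    rw [mem_closedBall_zero_iff]
    exact (hr₁ t (Ico_subset_Icc_self ht)).trans (le_max_left _ _)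
  · intro t ht
    rw [mem_closedBall_zero_iff]
    exact (hr₂ t (Ico_subset_Icc_self ht)).trans (le_max_right _ _)

omit [FiniteDimensional ℝ E] in
theorem hasDerivWithinAt_fst {F : Type*} [NormedAddCommGroup F] [NormedSpace ℝ F] {z : ℝ → E × F}
    {z' : E × F} {s : Set ℝ} {t : ℝ} (h : HasDerivWithinAt z z' s t) :
    HasDerivWithinAt (fun τ => (z τ).1) z'.1 s t :=
  ((ContinuousLinearMap.fst ℝ E F).hasFDerivAt (x := z t)).comp_hasDerivWithinAt t h

omit [FiniteDimensional ℝ E] in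
theorem hasDerivWithinAt_snd {F : Type*} [NormedAddCommGroup F] [NormedSpace ℝ F] {z : ℝ → E × F}
    {z' : E × F} {s : Set ℝ} {t : ℝ} (h : HasDerivWithinAt z z' s t) :
    HasDerivWithinAt (fun τ => (z τ).2) z'.2 s t :=
  ((ContinuousLinearMap.snd ℝ E F).hasFDerivAt (x := z t)).comp_hasDerivWithinAt t h

/-- Global existence from an a priori bound which is insensitive to slowing down the field. -/
theorem exists_global_solution (hV : ContDiff ℝ 1 V) (x₀ : E)
    (bound : ∀ T : ℝ, 0 ≤ T → ∃ r : ℝ, ∀ θ : ℝ → ℝ, (∀ t, 0 ≤ θ t ∧ θ t ≤ 1) → ∀ x : ℝ → E,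
      x 0 = x₀ → (∀ t ∈ Icc 0 T, HasDerivWithinAt x (θ t • V (x t)) (Icc 0 T) t) →
      ∀ t ∈ Icc 0 T, ‖x t‖ ≤ r) :
    ∃ x : ℝ → E, x 0 = x₀ ∧ ∀ t ∈ Ici (0 : ℝ), HasDerivWithinAt x (V (x t)) (Ici 0) t := by
  have : ProperSpace E := FiniteDimensional.proper ℝ E
  have hloc : ∀ T : ℝ, 0 ≤ T → ∃ x : ℝ → E, x 0 = x₀ ∧
      ∀ t ∈ Icc 0 T, HasDerivWithinAt x (V (x t)) (Icc 0 T) t := by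
    intro T hT
    obtain ⟨r, hr⟩ := bound T hT
    -- The cut-off field β V is globally Lipschitz, so Picard-Lindelöf reaches T. Its solution is
    -- one for V slowed down by θ = β(x t), so the a priori bound keeps it where β = 1.
    let β : ContDiffBump (0 : E) := ⟨max r 0 + 1, max r 0 + 2, by positivity, by linarith⟩
    have hW : ContDiff ℝ 1 fun x => β x • V x := β.contDiff.smul hV
    have hsupp : HasCompactSupport fun x => β x • V x := β.hasCompactSupport.smul_right
    obtain ⟨K, hK⟩ := ContDiff.lipschitzWith_of_hasCompactSupport hsupp hW one_ne_zero
    obtain ⟨L, hL⟩ := hsupp.exists_bound_of_continuous hW.continuous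
    have hL0 : 0 ≤ L := (norm_nonneg _).trans (hL 0)
    have hpl : IsPicardLindelof (fun _ x => β x • V x) (tmin := 0) (tmax := T)
        ⟨0, left_mem_Icc.2 hT⟩ x₀ (L.toNNReal * T.toNNReal) 0 L.toNNReal K := by
      refine IsPicardLindelof.of_time_independent (fun x _ => ?_) hK.lipschitzOnWith ?_
      · rw [Real.coe_toNNReal _ hL0]; exact hL x
      · simp [Real.coe_toNNReal _ hL0, hT]
    obtain ⟨x, hx0, hx⟩ := hpl.exists_eq_forall_mem_Icc_hasDerivWithinAt₀
    refine ⟨x, hx0, fun t ht => ?_⟩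
    have hb := hr (fun t => β (x t)) (fun t => ⟨β.nonneg, β.le_one⟩) x hx0 hx t ht
    have hone : β (x t) = 1 := by
      apply β.one_of_mem_closedBall
      rw [mem_closedBall_zero_iff]
      have := le_max_left r 0
      change _ ≤ max r 0 + 1
      linarith
    have := hx t ht
    simp only [hone, one_smul] at this
    exact this
  choose x hx0 hx using fun N : ℕ => hloc (N + 1) (by positivity)
  have hmono : ∀ {N M : ℕ}, N ≤ M → EqOn (x M) (x N) (Icc 0 (N + 1)) := by
    intro N M hNM
    have hsub : Icc (0 : ℝ) (N + 1) ⊆ Icc 0 (M + 1) :=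
      Icc_subset_Icc_right (by have : (N : ℝ) ≤ M := by exact_mod_cast hNM
                               linarith)
    exact eqOn_of_hasDerivWithinAt hV (fun t ht => (hx M t (hsub ht)).mono hsub) (hx N)
      ((hx0 M).trans (hx0 N).symm)
  -- The N-th solution lives up to N + 1, so t lies strictly before the end of the interval of index
  -- ⌈t⌉₊ and derivatives within [0, ∞) are available.
  set y : ℝ → E := fun t => x ⌈t⌉₊ t with hy
  have hyN : ∀ N : ℕ, EqOn y (x N) (Icc 0 (N + 1)) := by
    intro N t ht
    have h1 : t ∈ Icc (0 : ℝ) (⌈t⌉₊ + 1) := ⟨ht.1, (Nat.le_ceil t).trans (by linarith)⟩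
    rcases le_total ⌈t⌉₊ N with h | h
    · exact (hmono h h1).symm
    · exact hmono h ht
  refine ⟨y, by simpa [hy] using hx0 0, fun t ht => ?_⟩
  have ht0 : (0 : ℝ) ≤ t := ht
  have hlt : t < (⌈t⌉₊ : ℝ) + 1 := (Nat.le_ceil t).trans_lt (by linarith)
  have htm : t ∈ Icc (0 : ℝ) (⌈t⌉₊ + 1) := ⟨ht0, hlt.le⟩
  have h1 := (hx ⌈t⌉₊ t htm).congr_of_mem (hyN ⌈t⌉₊) htm
  refine h1.mono_of_mem_nhdsWithin ?_
  rw [← Ici_inter_Iic]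
  exact Filter.inter_mem self_mem_nhdsWithin (mem_nhdsWithin_of_mem_nhds (Iic_mem_nhds hlt))

/-- Grönwall's inequality for a scalar differential inequality. -/
theorem le_mul_exp_of_deriv_le {f f' G g : ℝ → ℝ} {T : ℝ} {s : Set ℝ} (hs : Icc 0 T ⊆ s)
    (hf : ∀ t ∈ Icc 0 T, HasDerivWithinAt f (f' t) s t)
    (hG : ∀ t ∈ Icc 0 T, HasDerivWithinAt G (g t) s t)
    (h : ∀ t ∈ Icc 0 T, f' t ≤ g t * f t) {t : ℝ} (ht : t ∈ Icc 0 T) :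
    f t ≤ f 0 * Real.exp (G t - G 0) := by
  have hd : ∀ t ∈ Icc 0 T, HasDerivWithinAt (fun t => f t * Real.exp (-(G t)))
      ((f' t - g t * f t) * Real.exp (-(G t))) s t := fun t ht =>
    ((hf t ht).mul (hG t ht).fun_neg.exp).congr_deriv (by ring)
  have hanti : AntitoneOn (fun t => f t * Real.exp (-(G t))) (Icc 0 T) :=
    antitoneOn_of_hasDerivWithinAt_nonpos (convex_Icc 0 T)
      (fun t ht => (hd t ht).continuousWithinAt.mono hs)
      (fun t ht => (hd t (interior_subset ht)).mono (interior_subset.trans hs)) fun t ht => by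
      have := h t (interior_subset ht)
      exact mul_nonpos_of_nonpos_of_nonneg (by linarith) (Real.exp_pos _).le
  have h1 := hanti (left_mem_Icc.2 (ht.1.trans ht.2)) ht ht.1
  simp only at h1
  rw [sub_eq_neg_add, add_comm, Real.exp_add]
  calc f t = f t * Real.exp (-(G t)) * Real.exp (G t) := by
        rw [mul_assoc, ← Real.exp_add]; simp
    _ ≤ f 0 * Real.exp (-(G 0)) * Real.exp (G t) := by gcongr
    _ = _ := by ring

end ODE

/-! ### The flow solved jointly with its scaling matrices. -/

section Augmented

variable {m n k : ℕ}

/-- The phase space of the gradient flow together with its left and right scaling matrices. -/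
abbrev PhaseSpace (m n k : ℕ) : Type :=
  (Fin k → Fin m → Fin n → ℝ) × (Fin m → Fin m → ℝ) × (Fin n → Fin n → ℝ)

/-- The gradient flow field on tuples of matrices, as functions. -/
def flowField (x : Fin k → Matrix (Fin m) (Fin n) ℝ) : Fin k → Fin m → Fin n → ℝ :=
  fun i a b => field x i a b

/-- The gradient flow field, together with the equations for the scaling matrices. -/
def phaseField (X : Fin k → Matrix (Fin m) (Fin n) ℝ) (L : Matrix (Fin m) (Fin m) ℝ)
    (R : Matrix (Fin n) (Fin n) ℝ) : PhaseSpace m n k :=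
  (flowField X, fun a b => (errL X * L) a b, fun a b => (R * errR X) a b)

theorem errL_apply (A : Fin k → Matrix (Fin m) (Fin n) ℝ) (a b : Fin m) :
    errL A a b = (∑ i, ∑ c, ∑ d, A i c d ^ 2) * (1 : Matrix (Fin m) (Fin m) ℝ) a b -
      m * ∑ i, ∑ c, A i a c * A i b c := by
  simp only [errL, size, frobSq, leftMarginal, Matrix.sub_apply, Matrix.smul_apply,
    Matrix.sum_apply, Matrix.mul_apply, transpose_apply, smul_eq_mul]

theorem errR_apply (A : Fin k → Matrix (Fin m) (Fin n) ℝ) (a b : Fin n) :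
    errR A a b = (∑ i, ∑ c, ∑ d, A i c d ^ 2) * (1 : Matrix (Fin n) (Fin n) ℝ) a b -
      n * ∑ i, ∑ c, A i c a * A i c b := by
  simp only [errR, size, frobSq, rightMarginal, Matrix.sub_apply, Matrix.smul_apply,
    Matrix.sum_apply, Matrix.mul_apply, transpose_apply, smul_eq_mul]

theorem field_apply (A : Fin k → Matrix (Fin m) (Fin n) ℝ) (i : Fin k) (a : Fin m) (b : Fin n) :
    field A i a b = ∑ c, errL A a c * A i c b + ∑ c, A i a c * errR A c b := by
  simp only [field, Matrix.add_apply, Matrix.mul_apply]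

theorem contDiff_errL (a b : Fin m) :
    ContDiff ℝ 1 fun x : Fin k → Fin m → Fin n → ℝ => errL (m := m) (n := n) (k := k) x a b := by
  rw [funext fun x : Fin k → Fin m → Fin n → ℝ => errL_apply x a b]
  fun_prop

theorem contDiff_errR (a b : Fin n) :
    ContDiff ℝ 1 fun x : Fin k → Fin m → Fin n → ℝ => errR (m := m) (n := n) (k := k) x a b := by
  rw [funext fun x : Fin k → Fin m → Fin n → ℝ => errR_apply x a b]
  fun_prop

theorem contDiff_flowField :
    ContDiff ℝ 1 fun x : Fin k → Fin m → Fin n → ℝ => flowField (m := m) (n := n) (k := k) x := by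
  refine contDiff_pi.2 fun i => contDiff_pi.2 fun a => contDiff_pi.2 fun b => ?_
  unfold flowField
  rw [funext fun x : Fin k → Fin m → Fin n → ℝ => field_apply x i a b]
  refine ContDiff.add (ContDiff.sum fun c _ => (contDiff_errL a c).mul ?_)
    (ContDiff.sum fun c _ => ContDiff.mul ?_ (contDiff_errR c b)) <;> fun_prop

theorem contDiff_phaseField :
    ContDiff ℝ 1 fun z : PhaseSpace m n k => phaseField z.1 z.2.1 z.2.2 := by
  refine (contDiff_flowField.comp contDiff_fst).prodMk (ContDiff.prodMk ?_ ?_)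
  · refine contDiff_pi.2 fun a => contDiff_pi.2 fun b => ?_
    rw [funext fun z : PhaseSpace m n k => Matrix.mul_apply (M := errL z.1) (N := z.2.1)]
    refine ContDiff.sum fun c _ => ((contDiff_errL a c).comp contDiff_fst).mul ?_
    fun_prop
  · refine contDiff_pi.2 fun a => contDiff_pi.2 fun b => ?_
    rw [funext fun z : PhaseSpace m n k => Matrix.mul_apply (M := z.2.2) (N := errR z.1)]
    refine ContDiff.sum fun c _ => ContDiff.mul ?_ ((contDiff_errR c b).comp contDiff_fst)
    fun_prop

/-- E ⪯ s I because the marginal is positive semidefinite. No balance is needed for this one-sided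
bound, so global existence holds for every initial operator. -/
theorem trace_errL_le (A : Fin k → Matrix (Fin m) (Fin n) ℝ) {q : Type*} [Fintype q]
    (U : Matrix (Fin m) q ℝ) : trace (Uᵀ * errL A * U) ≤ size A * fsq U := by
  have h := sum_fsq_mul A U
  have : 0 ≤ (m : ℝ) * ∑ i, fsq (Uᵀ * A i) :=
    mul_nonneg (Nat.cast_nonneg m) (Finset.sum_nonneg fun i _ => fsq_nonneg _)
  linarith

theorem trace_errR_le (A : Fin k → Matrix (Fin m) (Fin n) ℝ) {q : Type*} [Fintype q]
    (U : Matrix (Fin n) q ℝ) : trace (Uᵀ * errR A * U) ≤ size A * fsq U := by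
  have := trace_errL_le (transposeOp A) U
  rwa [errL_transposeOp, size_transposeOp] at this

theorem abs_le_of_fsq_le {p q : Type*} [Fintype p] [Fintype q] {M : Matrix p q ℝ} {c : ℝ}
    (h : fsq M ≤ c) (a : p) (b : q) : |M a b| ≤ 1 + c := by
  have h1 : M a b ^ 2 ≤ ∑ b, M a b ^ 2 :=
    Finset.single_le_sum (f := fun b => M a b ^ 2) (fun _ _ => sq_nonneg _) (Finset.mem_univ b)
  have h2 : ∑ b, M a b ^ 2 ≤ fsq M :=
    Finset.single_le_sum (f := fun a => ∑ b, M a b ^ 2)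
      (fun _ _ => Finset.sum_nonneg fun _ _ => sq_nonneg _) (Finset.mem_univ a)
  rw [abs_le]
  constructor <;> nlinarith [sq_nonneg (M a b - 1), sq_nonneg (M a b + 1)]

theorem fsq_le_size (A : Fin k → Matrix (Fin m) (Fin n) ℝ) (i : Fin k) : fsq (A i) ≤ size A :=
  Finset.single_le_sum (f := fun i => fsq (A i)) (fun _ _ => fsq_nonneg _) (Finset.mem_univ i)

/-- A slowdown factor in [0, 1] keeps the size decreasing; Grönwall with rate 2s₀ then bounds L and
R. -/
theorem phase_apriori_bound (hm : m ≠ 0) (hn : n ≠ 0) {T : ℝ} {θ : ℝ → ℝ}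
    (hθ : ∀ t, 0 ≤ θ t ∧ θ t ≤ 1) {X : ℝ → Fin k → Matrix (Fin m) (Fin n) ℝ}
    {L : ℝ → Matrix (Fin m) (Fin m) ℝ} {R : ℝ → Matrix (Fin n) (Fin n) ℝ}
    (hX : ∀ t ∈ Icc 0 T, ∀ i, HasEntryDeriv (fun τ => X τ i) (θ t • field (X t) i) (Icc 0 T) t)
    (hL : ∀ t ∈ Icc 0 T, HasEntryDeriv L (θ t • (errL (X t) * L t)) (Icc 0 T) t)
    (hR : ∀ t ∈ Icc 0 T, HasEntryDeriv R (θ t • (R t * errR (X t))) (Icc 0 T) t)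
    {t : ℝ} (ht : t ∈ Icc 0 T) :
    size (X t) ≤ size (X 0) ∧ fsq (L t) ≤ fsq (L 0) * Real.exp (2 * size (X 0) * T) ∧
      fsq (R t) ≤ fsq (R 0) * Real.exp (2 * size (X 0) * T) := by
  have hs0 := size_nonneg (X 0)
  have hs : ∀ t ∈ Icc 0 T, size (X t) ≤ size (X 0) := by
    have hd : ∀ t ∈ Icc 0 T,
        HasDerivWithinAt (fun τ => size (X τ)) (θ t * (-2 * delta (X t))) (Icc 0 T) t := by
      intro t ht
      refine (hasDerivWithinAt_size (hX t ht)).congr_deriv ?_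
      rw [← trace_leftMarginalDeriv (X t) hm hn, leftMarginalDeriv, ← smul_eq_mul, ← trace_smul,
        Finset.smul_sum]
      simp
    have hanti : AntitoneOn (fun τ => size (X τ)) (Icc 0 T) :=
      antitoneOn_of_hasDerivWithinAt_nonpos (convex_Icc 0 T)
        (fun t ht => (hd t ht).continuousWithinAt)
        (fun t ht => (hd t (interior_subset ht)).mono interior_subset) fun t _ =>
        mul_nonpos_of_nonneg_of_nonpos (hθ t).1 (by linarith [delta_nonneg (X t)])
    exact fun t ht => hanti (left_mem_Icc.2 (ht.1.trans ht.2)) ht ht.1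
  have hlin : ∀ {x y : ℝ} {τ : ℝ}, τ ∈ Icc 0 T → 0 ≤ y → x ≤ size (X τ) * y →
      2 * (θ τ * x) ≤ 2 * size (X 0) * y := by
    intro x y τ hτ hy hx
    have h1 : x ≤ size (X 0) * y := hx.trans (mul_le_mul_of_nonneg_right (hs τ hτ) hy)
    have h2 : θ τ * x ≤ θ τ * (size (X 0) * y) := mul_le_mul_of_nonneg_left h1 (hθ τ).1
    have h3 : θ τ * (size (X 0) * y) ≤ 1 * (size (X 0) * y) :=
      mul_le_mul_of_nonneg_right (hθ τ).2 (mul_nonneg hs0 hy)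
    linarith
  have hexp : ∀ {c : ℝ}, 0 ≤ c → c * Real.exp (2 * size (X 0) * t - 2 * size (X 0) * 0) ≤
      c * Real.exp (2 * size (X 0) * T) := by
    intro c hc
    have := ht.2
    gcongr
    rw [mul_zero, sub_zero]
    gcongr
  have hlinear : ∀ τ ∈ Icc 0 T, HasDerivWithinAt (fun τ => 2 * size (X 0) * τ) (2 * size (X 0))
      (Icc 0 T) τ := fun τ _ =>
    ((hasDerivWithinAt_id τ _).const_mul (2 * size (X 0))).congr_deriv (by ring)
  refine ⟨hs t ht, ?_, ?_⟩
  · refine (le_mul_exp_of_deriv_le subset_rfl (fun τ hτ => (hL τ hτ).fsq) hlinear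
      (fun τ hτ => ?_) ht).trans (hexp (fsq_nonneg _))
    rw [mul_smul_comm, trace_smul, smul_eq_mul, ← Matrix.mul_assoc]
    exact hlin hτ (fsq_nonneg _) (trace_errL_le _ _)
  · refine (le_mul_exp_of_deriv_le subset_rfl (fun τ hτ => (hR τ hτ).fsq) hlinear
      (fun τ hτ => ?_) ht).trans (hexp (fsq_nonneg _))
    rw [mul_smul_comm, trace_smul, smul_eq_mul, ← Matrix.mul_assoc, Matrix.mul_assoc]
    refine hlin hτ (fsq_nonneg _) ?_
    have := trace_errR_le (X τ) (R τ)ᵀ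
    rw [transpose_transpose, fsq_transpose] at this
    rwa [Matrix.mul_assoc, trace_mul_comm, Matrix.mul_assoc, trace_mul_comm, Matrix.mul_assoc] at this

theorem exists_flow_with_scalings (hm : m ≠ 0) (hn : n ≠ 0)
    (A : Fin k → Matrix (Fin m) (Fin n) ℝ) :
    ∃ (X : ℝ → Fin k → Matrix (Fin m) (Fin n) ℝ) (L : ℝ → Matrix (Fin m) (Fin m) ℝ)
      (R : ℝ → Matrix (Fin n) (Fin n) ℝ), X 0 = A ∧ L 0 = 1 ∧ R 0 = 1 ∧ IsFlow X ∧
      (∀ t ∈ Ici (0 : ℝ), HasEntryDeriv L (errL (X t) * L t) (Ici 0) t) ∧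
      (∀ t ∈ Ici (0 : ℝ), HasEntryDeriv R (R t * errR (X t)) (Ici 0) t) := by
  have hentry : ∀ {z : ℝ → PhaseSpace m n k} {z' : PhaseSpace m n k} {s : Set ℝ} {t : ℝ},
      HasDerivWithinAt z z' s t →
      (∀ i, HasEntryDeriv (fun τ => ((z τ).1 i : Matrix (Fin m) (Fin n) ℝ)) (z'.1 i) s t) ∧
      HasEntryDeriv (fun τ => ((z τ).2.1 : Matrix (Fin m) (Fin m) ℝ)) z'.2.1 s t ∧
      HasEntryDeriv (fun τ => ((z τ).2.2 : Matrix (Fin n) (Fin n) ℝ)) z'.2.2 s t := by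
    intro z z' s t hz
    have h1 := hasDerivWithinAt_fst hz
    have h3 := hasDerivWithinAt_fst (hasDerivWithinAt_snd hz)
    have h4 := hasDerivWithinAt_snd (hasDerivWithinAt_snd hz)
    refine ⟨fun i a b => ?_, fun a b => ?_, fun a b => ?_⟩
    · exact hasDerivWithinAt_pi.1 (hasDerivWithinAt_pi.1 (hasDerivWithinAt_pi.1 h1 i) a) b
    · exact hasDerivWithinAt_pi.1 (hasDerivWithinAt_pi.1 h3 a) b
    · exact hasDerivWithinAt_pi.1 (hasDerivWithinAt_pi.1 h4 a) b
  obtain ⟨z, hz0, hz⟩ := exists_global_solution (contDiff_phaseField (m := m) (n := n) (k := k))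
    (A, (1 : Matrix (Fin m) (Fin m) ℝ), (1 : Matrix (Fin n) (Fin n) ℝ)) (by
      intro T hT
      refine ⟨1 + (size A + fsq (1 : Matrix (Fin m) (Fin m) ℝ) * Real.exp (2 * size A * T) +
        fsq (1 : Matrix (Fin n) (Fin n) ℝ) * Real.exp (2 * size A * T)), ?_⟩
      intro θ hθ z hz0 hz t ht
      have hb := phase_apriori_bound hm hn (T := T) (θ := θ) hθ
        (X := fun τ => (z τ).1) (L := fun τ => (z τ).2.1) (R := fun τ => (z τ).2.2)
        (fun t ht => (hentry (hz t ht)).1) (fun t ht => (hentry (hz t ht)).2.1)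
        (fun t ht => (hentry (hz t ht)).2.2) ht
      simp only [hz0] at hb
      obtain ⟨hb1, hb2, hb3⟩ := hb
      have p1 := size_nonneg A
      have p2 : 0 ≤ fsq (1 : Matrix (Fin m) (Fin m) ℝ) * Real.exp (2 * size A * T) :=
        mul_nonneg (fsq_nonneg _) (Real.exp_pos _).le
      have p3 : 0 ≤ fsq (1 : Matrix (Fin n) (Fin n) ℝ) * Real.exp (2 * size A * T) :=
        mul_nonneg (fsq_nonneg _) (Real.exp_pos _).le
      refine norm_prod_le_iff.2 ⟨?_, norm_prod_le_iff.2 ⟨?_, ?_⟩⟩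
      · refine (pi_norm_le_iff_of_nonneg (by positivity)).2 fun i =>
          (pi_norm_le_iff_of_nonneg (by positivity)).2 fun a =>
          (pi_norm_le_iff_of_nonneg (by positivity)).2 fun b => ?_
        have := abs_le_of_fsq_le ((fsq_le_size _ i).trans hb1) a b
        rw [Real.norm_eq_abs]
        exact this.trans (by linarith)
      · refine (pi_norm_le_iff_of_nonneg (by positivity)).2 fun a =>
          (pi_norm_le_iff_of_nonneg (by positivity)).2 fun b => ?_
        have := abs_le_of_fsq_le hb2 a b
        rw [Real.norm_eq_abs]
        exact this.trans (by linarith)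
      · refine (pi_norm_le_iff_of_nonneg (by positivity)).2 fun a =>
          (pi_norm_le_iff_of_nonneg (by positivity)).2 fun b => ?_
        have := abs_le_of_fsq_le hb3 a b
        rw [Real.norm_eq_abs]
        exact this.trans (by linarith))
  refine ⟨fun t => (z t).1, fun t => (z t).2.1, fun t => (z t).2.2, ?_, ?_, ?_, ?_, ?_, ?_⟩
  · simp only [hz0]
  · simp only [hz0]
  · simp only [hz0]
  · exact fun t ht => (hentry (hz t ht)).1
  · exact fun t ht => (hentry (hz t ht)).2.1
  · exact fun t ht => (hentry (hz t ht)).2.2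

/-- The gradient flow is determined by its initial value. -/
theorem IsFlow.eqOn {X Y : ℝ → Fin k → Matrix (Fin m) (Fin n) ℝ} (hX : IsFlow X) (hY : IsFlow Y)
    (h0 : X 0 = Y 0) {t : ℝ} (ht : 0 ≤ t) : X t = Y t := by
  let W : (Fin k → Fin m → Fin n → ℝ) → Fin k → Fin m → Fin n → ℝ := fun x => flowField x
  have hd : ∀ Z : ℝ → Fin k → Fin m → Fin n → ℝ, IsFlow (m := m) (n := n) (k := k) Z →
      ∀ τ ∈ Icc 0 t, HasDerivWithinAt Z (W (Z τ)) (Icc 0 t) τ := by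
    intro Z hZ τ hτ
    rw [hasDerivWithinAt_pi]
    intro i
    rw [hasDerivWithinAt_pi]
    intro a
    rw [hasDerivWithinAt_pi]
    intro b
    exact (hZ τ hτ.1 i a b).mono Icc_subset_Ici_self
  exact eqOn_of_hasDerivWithinAt (V := W) contDiff_flowField (hd X hX) (hd Y hY) h0
    (right_mem_Icc.2 ht)

/-- The flow is obtained from the initial operator by the scaling matrices. -/
theorem IsFlow.eq_scaling {X : ℝ → Fin k → Matrix (Fin m) (Fin n) ℝ}
    {L : ℝ → Matrix (Fin m) (Fin m) ℝ} {R : ℝ → Matrix (Fin n) (Fin n) ℝ} (h : IsFlow X)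
    (hm : m ≠ 0) (hn : n ≠ 0) (hL0 : L 0 = 1) (hR0 : R 0 = 1)
    (hL : ∀ t ∈ Ici (0 : ℝ), HasEntryDeriv L (OperatorScaling.errL (X t) * L t) (Ici 0) t)
    (hR : ∀ t ∈ Ici (0 : ℝ), HasEntryDeriv R (R t * OperatorScaling.errR (X t)) (Ici 0) t)
    {t : ℝ} (ht : 0 ≤ t) (i : Fin k) : X t i = L t * X 0 i * R t := by
  -- Z solves the linear equation Z' = E Z + Z F with zero initial value, so Grönwall makes it
  -- vanish.
  set Z : ℝ → Matrix (Fin m) (Fin n) ℝ := fun τ => X τ i - L τ * X 0 i * R τ with hZ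
  have hd : ∀ τ ∈ Icc 0 t, HasEntryDeriv Z
      (OperatorScaling.errL (X τ) * Z τ + Z τ * OperatorScaling.errR (X τ)) (Ici 0) τ := by
    intro τ hτ
    refine ((h τ hτ.1 i).sub (((hL τ hτ.1).mul (hasEntryDeriv_const (X 0 i))).mul
      (hR τ hτ.1))).congr_deriv ?_
    simp only [field, hZ, Matrix.mul_sub, Matrix.sub_mul, Matrix.mul_zero, add_zero,
      Matrix.mul_assoc]
    abel
  have hs0 := size_nonneg (X 0)
  have key := le_mul_exp_of_deriv_le (G := fun τ => 4 * OperatorScaling.size (X 0) * τ)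
    (g := fun _ => 4 * OperatorScaling.size (X 0)) Icc_subset_Ici_self
    (fun τ hτ => (hd τ hτ).fsq)
    (fun τ _ => ((hasDerivWithinAt_id τ _).const_mul
      (4 * OperatorScaling.size (X 0))).congr_deriv (by ring)) (fun τ hτ => by
      rw [Matrix.mul_add, trace_add, ← Matrix.mul_assoc]
      have h1 := trace_errL_le (X τ) (Z τ)
      have h2 := trace_errR_le (X τ) (Z τ)ᵀ
      rw [transpose_transpose, fsq_transpose, trace_mul_comm] at h2
      have h3 := h.antitoneOn_size hm hn (mem_Ici.2 le_rfl) hτ.1 hτ.1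
      have h4 := mul_le_mul_of_nonneg_right h3 (fsq_nonneg (Z τ))
      simp only at h4
      linarith) (right_mem_Icc.2 ht)
  have hz0 : fsq (Z 0) = 0 := by simp [hZ, hL0, hR0, fsq]
  rw [hz0, zero_mul] at key
  exact sub_eq_zero.1 (eq_zero_of_fsq_eq_zero (le_antisymm key (fsq_nonneg _)))

end Augmented

end OperatorScaling

namespace OperatorScaling

open Matrix Set Filter Topology

variable {m n k : ℕ}

/-! ### Bounds for the scaling matrices. -/

section Propagator

variable {p : Type*} [Fintype p] [DecidableEq p] {L E : ℝ → Matrix p p ℝ} {H G : ℝ → ℝ} {t : ℝ}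

/-- Norm bounds for the solution of a linear equation with symmetric coefficients. -/
theorem propagator_bounds (hL0 : L 0 = 1)
    (hL : ∀ τ ∈ Icc 0 t, HasEntryDeriv L (E τ * L τ) (Ici 0) τ)
    (hH : ∀ τ ∈ Icc 0 t, SymBound (H τ) (E τ))
    (hG : ∀ τ ∈ Icc 0 t, HasDerivWithinAt G (H τ) (Ici 0) τ) (ht : 0 ≤ t) (x : p → ℝ) :
    (x ⬝ᵥ x) * Real.exp (-(2 * (G t - G 0))) ≤ (L t *ᵥ x) ⬝ᵥ (L t *ᵥ x) ∧
      (L t *ᵥ x) ⬝ᵥ (L t *ᵥ x) ≤ (x ⬝ᵥ x) * Real.exp (2 * (G t - G 0)) := by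
  have hf : ∀ τ ∈ Icc 0 t, HasDerivWithinAt (fun τ => (L τ *ᵥ x) ⬝ᵥ (L τ *ᵥ x))
      (2 * ((L τ *ᵥ x) ⬝ᵥ E τ *ᵥ (L τ *ᵥ x))) (Ici 0) τ := by
    intro τ hτ
    have h := ((hL τ hτ).transpose.mul (hL τ hτ)).dotProduct x x
    have e : ∀ M N : Matrix p p ℝ, x ⬝ᵥ (Mᵀ * N) *ᵥ x = (M *ᵥ x) ⬝ᵥ (N *ᵥ x) := fun M N => by
      rw [← mulVec_mulVec, dotProduct_mulVec, vecMul_transpose]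
    simp only [add_mulVec, dotProduct_add, e] at h
    refine h.congr_deriv ?_
    rw [dotProduct_comm (((E τ * L τ)) *ᵥ x), mulVec_mulVec]
    ring
  have hx : (L 0 *ᵥ x) ⬝ᵥ (L 0 *ᵥ x) = x ⬝ᵥ x := by rw [hL0, one_mulVec]
  constructor
  · have key := le_mul_exp_of_deriv_le (f := fun τ => -((L τ *ᵥ x) ⬝ᵥ (L τ *ᵥ x)))
      (G := fun τ => -(2 * G τ)) Icc_subset_Ici_self
      (fun τ hτ => (hf τ hτ).neg) (fun τ hτ => ((hG τ hτ).const_mul 2).neg) (fun τ hτ => by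
        have := (abs_le.1 (hH τ hτ (L τ *ᵥ x))).1
        linarith) (right_mem_Icc.2 ht)
    simp only [hx] at key
    have e : -(2 * G t) - -(2 * G 0) = -(2 * (G t - G 0)) := by ring
    rw [e] at key
    linarith
  · have key := le_mul_exp_of_deriv_le (f := fun τ => (L τ *ᵥ x) ⬝ᵥ (L τ *ᵥ x))
      (G := fun τ => 2 * G τ) Icc_subset_Ici_self
      hf (fun τ hτ => (hG τ hτ).const_mul 2) (fun τ hτ => by
        have := (abs_le.1 (hH τ hτ (L τ *ᵥ x))).2
        linarith) (right_mem_Icc.2 ht)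
    rw [hx] at key
    rwa [mul_sub]

theorem isUnit_of_le_mulVec {M : Matrix p p ℝ} {c : ℝ} (hc : 0 < c)
    (h : ∀ x, (x ⬝ᵥ x) * c ≤ (M *ᵥ x) ⬝ᵥ (M *ᵥ x)) : IsUnit M := by
  rw [← mulVec_injective_iff_isUnit]
  intro x y hxy
  have h1 := h (x - y)
  rw [mulVec_sub, sub_eq_zero.2 hxy, zero_dotProduct] at h1
  have h2 := dotProduct_self_nonneg' (x - y)
  have h3 : (x - y) ⬝ᵥ (x - y) = 0 := by nlinarith
  exact sub_eq_zero.1 (dotProduct_self_eq_zero.1 h3)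

theorem abs_entry_le {M : Matrix p p ℝ} {c : ℝ} (hc : 0 ≤ c)
    (h : ∀ x, (M *ᵥ x) ⬝ᵥ (M *ᵥ x) ≤ (x ⬝ᵥ x) * c ^ 2) (a b : p) : |M a b| ≤ c := by
  have h1 := h (Pi.single b 1)
  rw [mulVec_single_one] at h1
  simp only [dotProduct_single, Pi.single_eq_same, mul_one, one_mul] at h1
  have h2 : M.col b a * M.col b a ≤ M.col b ⬝ᵥ M.col b :=
    Finset.single_le_sum (f := fun a => M.col b a * M.col b a) (fun _ _ => mul_self_nonneg _)
      (Finset.mem_univ a)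
  refine abs_le_of_sq_le_sq ?_ hc
  rw [sq]
  exact h2.trans h1

end Propagator

/-! ### Time to near balance, and uniform control of the scalings. -/

namespace IsGapped

variable {ε lam : ℝ} {X : ℝ → Fin k → Matrix (Fin m) (Fin n) ℝ} (hA : IsGapped ε lam (X 0))
  (h : IsFlow X)

include hA h

theorem symBound {t : ℝ} (ht : 0 ≤ t) :
    SymBound (errorBound m (ε * size (X 0)) (lam * size (X 0) / 2) t) (errL (X t)) ∧
      SymBound (errorBound m (ε * size (X 0)) (lam * size (X 0) / 2) t) (errR (X t)) :=
  hA.symBound_errorBound h (T := t) (fun _ hτ => hA.delta_le h hτ.1) (right_mem_Icc.2 ht)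

theorem half_size_le {t : ℝ} (ht : 0 ≤ t) : size (X 0) / 2 ≤ size (X t) := by
  have h1 := hA.size_sub_le h (T := t) (fun _ hτ => hA.delta_le h hτ.1) (right_mem_Icc.2 ht)
  have h2 := hA.eps_le'
  have h3 := hA.lam_le
  have h4 : ε * size (X 0) ≤ 1 / 2 * size (X 0) :=
    mul_le_mul_of_nonneg_right (by linarith) hA.size_pos.le
  linarith

/-- Since √(2m) ≤ m, the factor `decay` is at most η from the stated time on. As 12ε ≤ 1/2 and s ≥
s₀/2, the errors are then at most ηs. -/
theorem nearlyDoublyBalanced {η t : ℝ} (hη : 0 < η) (ht : 0 ≤ t)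
    (hlog : 2 / (lam * size (X 0)) * Real.log (m / η) ≤ t) : NearlyDoublyBalanced η (X t) := by
  have hs := hA.size_pos
  have hl := hA.lam_pos
  have hm2 : (2 : ℝ) ≤ m := by exact_mod_cast hA.two_le
  have hr : 0 < lam * size (X 0) := mul_pos hl hs
  have hg := mul_pos hA.eps_pos hs
  have h1 : Real.exp (-(lam * size (X 0) / 2 * t)) ≤ η / m := by
    have h2 : Real.log (m / η) ≤ lam * size (X 0) / 2 * t := by
      rw [div_mul_eq_mul_div, div_le_iff₀ hr] at hlog
      linarith
    have h3 : Real.log (η / m) = -Real.log (m / η) := by rw [← Real.log_inv, inv_div]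
    rw [← Real.exp_log (by positivity : 0 < η / m), Real.exp_le_exp, h3]
    linarith
  have h2 : decay m (lam * size (X 0) / 2) t ≤ η := by
    have h3 : √(2 * (m : ℝ)) ≤ m := Real.sqrt_le_iff.2 ⟨by linarith, by nlinarith⟩
    calc decay m (lam * size (X 0) / 2) t ≤ m * (η / m) := by
          unfold decay; gcongr
      _ = η := by field_simp
  have h3 : errorBound m (ε * size (X 0)) (lam * size (X 0) / 2) t ≤ η * size (X t) := by
    refine (errorBound_le_decay hA.m_pos hg t).trans ?_
    have h4 := hA.half_size_le h ht
    have h5 := hA.eps_le'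
    have h6 := hA.lam_le
    have h7 := (decay_pos (μ := lam * size (X 0) / 2) hA.m_pos t).le
    calc 12 * (ε * size (X 0)) * decay m (lam * size (X 0) / 2) t
        ≤ 12 * (1 / 24 * size (X 0)) * η := by gcongr; linarith
      _ = η * (size (X 0) / 2) := by ring
      _ ≤ η * size (X t) := by gcongr
  obtain ⟨hL, hR⟩ := hA.symBound h ht
  exact nearlyDoublyBalanced_of_symBound _ hA.m_pos hA.n_pos (hL.mono h3) (hR.mono h3)

omit h in
-- The integral of the error bound is below 1 uniformly in time, so the singular values stay between
-- e⁻¹ and e.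
theorem propagator_bounds {q : ℕ} {L E : ℝ → Matrix (Fin q) (Fin q) ℝ} (hL0 : L 0 = 1)
    (hL : ∀ τ ∈ Ici (0 : ℝ), HasEntryDeriv L (E τ * L τ) (Ici 0) τ)
    (hH : ∀ τ ∈ Ici (0 : ℝ),
      SymBound (errorBound m (ε * size (X 0)) (lam * size (X 0) / 2) τ) (E τ))
    {t : ℝ} (ht : 0 ≤ t) (x : Fin q → ℝ) :
    (x ⬝ᵥ x) * Real.exp (-2) ≤ (L t *ᵥ x) ⬝ᵥ (L t *ᵥ x) ∧
      (L t *ᵥ x) ⬝ᵥ (L t *ᵥ x) ≤ (x ⬝ᵥ x) * Real.exp 1 ^ 2 := by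
  have hμ : 0 < lam * size (X 0) / 2 := by
    have := hA.size_pos
    have := hA.lam_pos
    positivity
  obtain ⟨h1, h2⟩ := OperatorScaling.propagator_bounds (t := t) hL0 (fun τ hτ => hL τ hτ.1)
    (fun τ hτ => hH τ hτ.1)
    (fun τ _ => (hasDerivAt_errorBoundInt hA.m_pos hμ.ne' τ).hasDerivWithinAt) ht x
  have h3 := hA.errorBoundInt_sub_le_lam t
  have h4 := hA.lam_le
  have hx := dotProduct_self_nonneg' x
  constructor
  · refine le_trans ?_ h1
    gcongr
    linarith
  · refine h2.trans ?_
    rw [← Real.exp_nat_mul]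
    refine mul_le_mul_of_nonneg_left (Real.exp_le_exp.2 ?_) hx
    push_cast
    linarith

end IsGapped

/-! ### Compactness and the exact scaling in the limit. -/

theorem continuous_delta :
    Continuous fun x : Fin k → Fin m → Fin n → ℝ => delta (m := m) (n := n) (k := k) x := by
  unfold delta frobSq
  refine Continuous.add (continuous_const.mul ?_) (continuous_const.mul ?_)
  · exact continuous_finsetSum _ fun a _ => continuous_finsetSum _ fun b _ =>
      (contDiff_errL a b).continuous.pow 2
  · exact continuous_finsetSum _ fun a _ => continuous_finsetSum _ fun b _ =>
      (contDiff_errR a b).continuous.pow 2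

theorem tendsto_delta {Y : ℕ → Fin k → Matrix (Fin m) (Fin n) ℝ}
    {B : Fin k → Matrix (Fin m) (Fin n) ℝ}
    (h : ∀ i a b, Tendsto (fun j => Y j i a b) atTop (𝓝 (B i a b))) :
    Tendsto (fun j => delta (Y j)) atTop (𝓝 (delta B)) := by
  have h1 : Tendsto (fun j => (fun i a b => Y j i a b : Fin k → Fin m → Fin n → ℝ)) atTop
      (𝓝 fun i a b => B i a b) :=
    tendsto_pi_nhds.2 fun i => tendsto_pi_nhds.2 fun a => tendsto_pi_nhds.2 fun b => h i a b
  exact (continuous_delta.tendsto _).comp h1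

theorem tendsto_size {Y : ℕ → Fin k → Matrix (Fin m) (Fin n) ℝ}
    {B : Fin k → Matrix (Fin m) (Fin n) ℝ}
    (h : ∀ i a b, Tendsto (fun j => Y j i a b) atTop (𝓝 (B i a b))) :
    Tendsto (fun j => size (Y j)) atTop (𝓝 (size B)) :=
  tendsto_finsetSum _ fun i _ => tendsto_finsetSum _ fun a _ => tendsto_finsetSum _ fun b _ =>
    (h i a b).pow 2

theorem tendsto_mul_entries {p q r : Type*} [Fintype q] {M : ℕ → Matrix p q ℝ}
    {N : ℕ → Matrix q r ℝ} {M' : Matrix p q ℝ} {N' : Matrix q r ℝ}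
    (hM : ∀ a b, Tendsto (fun j => M j a b) atTop (𝓝 (M' a b)))
    (hN : ∀ a b, Tendsto (fun j => N j a b) atTop (𝓝 (N' a b))) (a : p) (b : r) :
    Tendsto (fun j => (M j * N j) a b) atTop (𝓝 ((M' * N') a b)) := by
  simp only [Matrix.mul_apply]
  exact tendsto_finsetSum _ fun c _ => (hM a c).mul (hN c b)

/-- A sequence of matrices with singular values bounded from above and below has a subsequence
converging to an invertible matrix. -/
theorem exists_tendsto_isUnit {q : ℕ} {M : ℕ → Matrix (Fin q) (Fin q) ℝ} {c d : ℝ} (hc : 0 < c)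
    (hd : 0 ≤ d) (h1 : ∀ j x, (x ⬝ᵥ x) * c ≤ (M j *ᵥ x) ⬝ᵥ (M j *ᵥ x))
    (h2 : ∀ j x, (M j *ᵥ x) ⬝ᵥ (M j *ᵥ x) ≤ (x ⬝ᵥ x) * d ^ 2) :
    ∃ M' : Matrix (Fin q) (Fin q) ℝ, IsUnit M' ∧ ∃ φ : ℕ → ℕ, StrictMono φ ∧
      ∀ a b, Tendsto (fun j => M (φ j) a b) atTop (𝓝 (M' a b)) := by
  let S : ℕ → Fin q → Fin q → ℝ := fun j a b => M j a b
  have hS : ∀ j, S j ∈ Metric.closedBall (0 : Fin q → Fin q → ℝ) d := by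
    intro j
    rw [mem_closedBall_zero_iff]
    exact (pi_norm_le_iff_of_nonneg hd).2 fun a => (pi_norm_le_iff_of_nonneg hd).2 fun b =>
      abs_entry_le hd (h2 j) a b
  obtain ⟨M', -, φ, hφ, hlim⟩ := (isCompact_closedBall _ _).tendsto_subseq hS
  have hent : ∀ a b, Tendsto (fun j => M (φ j) a b) atTop (𝓝 (M' a b)) := fun a b =>
    tendsto_pi_nhds.1 (tendsto_pi_nhds.1 hlim a) b
  refine ⟨Matrix.of M', isUnit_of_le_mulVec hc fun x => ?_, φ, hφ, hent⟩
  have hvec : ∀ a, Tendsto (fun j => (M (φ j) *ᵥ x) a) atTop (𝓝 ((Matrix.of M' *ᵥ x) a)) := by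
    intro a
    simp only [mulVec, dotProduct, of_apply]
    exact tendsto_finsetSum _ fun b _ => (hent a b).mul_const _
  exact ge_of_tendsto' (tendsto_finsetSum _ fun a _ => (hvec a).mul (hvec a)) fun j => h1 (φ j) x

theorem leftMarginal_smul (A : Fin k → Matrix (Fin m) (Fin n) ℝ) (c : ℝ) :
    leftMarginal (fun i => c • A i) = c ^ 2 • leftMarginal A := by
  simp [leftMarginal, Finset.smul_sum, smul_smul, sq]

theorem leftMarginal_eq_of_delta_eq_zero {A : Fin k → Matrix (Fin m) (Fin n) ℝ} (hm : 0 < m)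
    (hs : 0 < size A) (h : delta A = 0) :
    leftMarginal (fun i => (√(size A))⁻¹ • A i) =
      (1 / (m : ℝ)) • (1 : Matrix (Fin m) (Fin m) ℝ) := by
  have hm' : (0 : ℝ) < m := by exact_mod_cast hm
  have h1 : fsq (errL A) = 0 :=
    le_antisymm ((fsq_errL_le hm).trans (by rw [h, mul_zero])) (fsq_nonneg _)
  have h2 := smul_leftMarginal A
  rw [eq_zero_of_fsq_eq_zero h1, sub_zero] at h2
  rw [leftMarginal_smul, inv_pow, Real.sq_sqrt hs.le]
  have h3 : leftMarginal A = (size A / m) • (1 : Matrix (Fin m) (Fin m) ℝ) := by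
    rw [div_eq_inv_mul, ← smul_smul, ← h2, smul_smul, inv_mul_cancel₀ hm'.ne', one_smul]
  rw [h3, smul_smul]
  congr 1
  field_simp

theorem marginals_eq_of_delta_eq_zero {A : Fin k → Matrix (Fin m) (Fin n) ℝ} (hm : 0 < m)
    (hn : 0 < n) (hs : 0 < size A) (h : delta A = 0) :
    leftMarginal (fun i => (√(size A))⁻¹ • A i) =
        (1 / (m : ℝ)) • (1 : Matrix (Fin m) (Fin m) ℝ) ∧
      rightMarginal (fun i => (√(size A))⁻¹ • A i) =
        (1 / (n : ℝ)) • (1 : Matrix (Fin n) (Fin n) ℝ) := by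
  refine ⟨leftMarginal_eq_of_delta_eq_zero hm hs h, ?_⟩
  have h1 := leftMarginal_eq_of_delta_eq_zero (A := transposeOp A) hn
    (by rwa [size_transposeOp]) (by rwa [delta_transposeOp])
  rw [← leftMarginal_transposeOp, ← h1, size_transposeOp]
  exact congrArg leftMarginal (funext fun i => by simp [transposeOp])

/-- The solutions of the equations for the scaling matrices stay in a compact set of invertible
matrices, which yields scalings for all times and an exact scaling in the limit. -/
theorem IsGapped.exists_scalings {ε lam : ℝ} {A : Fin k → Matrix (Fin m) (Fin n) ℝ}
    (hA : IsGapped ε lam A) :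
    ∃ X : ℝ → Fin k → Matrix (Fin m) (Fin n) ℝ, X 0 = A ∧ IsFlow X ∧
      (∀ t : ℝ, 0 ≤ t → IsScaling A (X t)) ∧
      ∃ B, IsScaling A B ∧ leftMarginal B = (1 / (m : ℝ)) • (1 : Matrix (Fin m) (Fin m) ℝ) ∧
        rightMarginal B = (1 / (n : ℝ)) • (1 : Matrix (Fin n) (Fin n) ℝ) := by
  have hm := hA.two_le
  have hmn := hA.le
  obtain ⟨X, L, R, rfl, hL0, hR0, hX, hL, hR⟩ :=
    exists_flow_with_scalings (by omega) (by omega) A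
  have bL := fun {t : ℝ} (ht : 0 ≤ t) => hA.propagator_bounds hL0 hL 
    (fun τ hτ => (hA.symBound hX hτ).1) ht
  -- Transposing R' = R F gives (Rᵀ)' = F Rᵀ, the form covered by the propagator bounds.
  have bR := fun {t : ℝ} (ht : 0 ≤ t) => hA.propagator_bounds (L := fun τ => (R τ)ᵀ)
    (E := fun τ => errR (X τ)) (by simp [hR0])
    (fun τ hτ => (hR τ hτ).transpose.congr_deriv (by
      rw [transpose_mul, (isSymm_errR _).eq]))
    (fun τ hτ => (hA.symBound hX hτ).2) ht
  have hsc : ∀ {t : ℝ}, 0 ≤ t → ∀ i, X t i = L t * X 0 i * R t := fun ht i =>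
    hX.eq_scaling (by omega) (by omega) hL0 hR0 hL hR ht i
  have he := Real.exp_pos (-2)
  have he1 := (Real.exp_pos 1).le
  have hunit : ∀ {q : ℕ} {M : Matrix (Fin q) (Fin q) ℝ}, IsUnit Mᵀ → IsUnit M := fun h => by
    rwa [isUnit_transpose] at h
  refine ⟨X, rfl, hX, fun t ht => ⟨L t, R t, isUnit_of_le_mulVec he fun x => (bL ht x).1,
    hunit (isUnit_of_le_mulVec he fun x => (bR ht x).1), hsc ht⟩, ?_⟩
  have hj0 : ∀ j : ℕ, (0 : ℝ) ≤ (j : ℝ) := fun j => Nat.cast_nonneg _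
  obtain ⟨L', hL'u, φ₁, hφ₁, hL'⟩ := exists_tendsto_isUnit (M := fun j : ℕ => L j) he he1
    (fun j x => (bL (hj0 j) x).1) (fun j x => (bL (hj0 j) x).2)
  obtain ⟨R', hR'u, φ₂, hφ₂, hR'⟩ := exists_tendsto_isUnit (M := fun j : ℕ => (R (φ₁ j))ᵀ) he he1
    (fun j x => (bR (hj0 _) x).1) (fun j x => (bR (hj0 _) x).2)
  set φ : ℕ → ℕ := fun j => φ₁ (φ₂ j) with hφd
  have hφ : StrictMono φ := hφ₁.comp hφ₂
  have hj : ∀ j : ℕ, (0 : ℝ) ≤ (φ j : ℝ) := fun j => hj0 _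
  set B : Fin k → Matrix (Fin m) (Fin n) ℝ := fun i => L' * X 0 i * R'ᵀ with hB
  have hlim : ∀ i a b, Tendsto (fun j => X (φ j) i a b) atTop (𝓝 (B i a b)) := by
    intro i
    simp only [hsc (hj _) i, hB]
    exact tendsto_mul_entries (tendsto_mul_entries
      (fun a b => (hL' a b).comp hφ₂.tendsto_atTop) fun _ _ => tendsto_const_nhds)
      fun a b => hR' b a
  -- The limit keeps half of the size; this makes normalisation to size one possible.
  have hsize : size (X 0) / 2 ≤ size B :=
    ge_of_tendsto' (tendsto_size hlim) fun j => hA.half_size_le hX (hj j)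
  have hr : 0 < lam * size (X 0) := mul_pos hA.lam_pos hA.size_pos
  have hdelta : delta B = 0 := by
    refine le_antisymm ?_ (delta_nonneg _)
    have h2 : Tendsto
        (fun j : ℕ => delta (X 0) * Real.exp (-(lam * size (X 0) * (φ j : ℝ))))
        atTop (𝓝 (delta (X 0) * 0)) := by
      refine (Real.tendsto_exp_neg_atTop_nhds_zero.comp ?_).const_mul _
      exact (tendsto_natCast_atTop_atTop.comp hφ.tendsto_atTop).const_mul_atTop hr
    rw [mul_zero] at h2
    exact le_of_tendsto_of_tendsto' (tendsto_delta hlim) h2 fun j => hA.delta_le hX (hj j)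
  have hspos : 0 < size B := lt_of_lt_of_le (half_pos hA.size_pos) hsize
  obtain ⟨e1, e2⟩ := marginals_eq_of_delta_eq_zero (by omega) (by omega) hspos hdelta
  have hc : (√(size B))⁻¹ ≠ 0 := (inv_pos.2 (Real.sqrt_pos.2 hspos)).ne'
  refine ⟨fun i => (√(size B))⁻¹ • B i, ⟨(√(size B))⁻¹ • L', R'ᵀ, ?_, ?_, fun i => ?_⟩, e1, e2⟩
  · have := hL'u.smul (Units.mk0 _ hc)
    exact this
  · rwa [isUnit_transpose]
  · simp [hB]

end OperatorScaling

theorem theoremt :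
    ∃ C : ℝ, 0 < C ∧ ∃ K : ℝ, 0 < K ∧
      ∀ (m n k : ℕ), 2 ≤ m → m ≤ n →
      ∀ (A : Fin k → Matrix (Fin m) (Fin n) ℝ), A ≠ 0 →
      ∀ (ε lam : ℝ), 0 < lam →
        OperatorScaling.NearlyDoublyBalanced ε A →
        OperatorScaling.HasSpectralGap lam A →
        C * ε * Real.log m ≤ lam ^ 2 →
        -- the gradient flow exists for all time
        (∃ X : ℝ → Fin k → Matrix (Fin m) (Fin n) ℝ, OperatorScaling.IsGradientFlow A X) ∧
        (∀ X : ℝ → Fin k → Matrix (Fin m) (Fin n) ℝ, OperatorScaling.IsGradientFlow A X →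
          -- linear convergence
          (∀ t : ℝ, 0 ≤ t →
            OperatorScaling.delta (X t) ≤
              OperatorScaling.delta A * Real.exp (-(lam * OperatorScaling.size A * t))) ∧
          -- the flow stays among the scalings of the initial operator
          (∀ t : ℝ, 0 ≤ t → OperatorScaling.IsScaling A (X t)) ∧
          -- time needed to become nearly doubly balanced
          (∀ η : ℝ, 0 < η → ∀ t : ℝ, 0 ≤ t →
            K / (lam * OperatorScaling.size A) * Real.log (m / η) ≤ t →
              OperatorScaling.NearlyDoublyBalanced η (X t))) ∧
        -- an exact scaling, doubly balanced of size one, exists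
        (∃ B : Fin k → Matrix (Fin m) (Fin n) ℝ, OperatorScaling.IsScaling A B ∧
          OperatorScaling.leftMarginal B = (1 / (m : ℝ)) • (1 : Matrix (Fin m) (Fin m) ℝ) ∧
          OperatorScaling.rightMarginal B = (1 / (n : ℝ)) • (1 : Matrix (Fin n) (Fin n) ℝ)) := by
  -- K = 2 because the error matrices decay at half the rate λ s₀ of Δ.
  refine ⟨4096, by norm_num, 2, by norm_num, ?_⟩
  intro m n k hm hmn A hA ε lam hlam hb hg hε
  have hgap := OperatorScaling.isGapped_of_hasSpectralGap A hm hmn hA hlam hb hg hε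
  obtain ⟨Y, hY0, hY, hsc, hexact⟩ := hgap.exists_scalings
  refine ⟨⟨Y, hY0, fun t ht i => hY t ht i⟩, fun X hX => ?_, hexact⟩
  have hflow := hX.isFlow
  obtain rfl : X 0 = A := hX.1
  refine ⟨fun t ht => hgap.delta_le hflow ht, fun t ht => ?_, fun η hη t ht hlog =>
    hgap.nearlyDoublyBalanced hflow hη ht hlog⟩
  -- Scalings were built for the constructed flow Y; uniqueness carries them to an arbitrary flow X.
  rw [hflow.eqOn hY hY0.symm ht]
  exact hsc t ht
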